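/- **Symmetric Rectilinear Steiner Arborescence (SRSA).** An instance is an ordered set $R=(r_1,\dots,r_N)$ of $N$ distinct points (terminals, requests) $r_i=(x_i,y_i)$ with $x_i\ge 0$ and $0\le y_1\le y_2\le\dots\le y_N$. A feasible solution is a finite set of horizontal and vertical segments in the closed positive quadrant such that every $r_i$ can be reached from the origin $(0,0)$ by a rectilinear path that is contained in the union of the segments and along which the $y$-coordinate never decreases. The cost of a solution is the sum of the lengths of its segments, and $\mathrm{opt}(R)$ is the infimum of the costs of the feasible solutions. A deterministic online algorithm receives $r_1,r_2,\dots$ one after another. When $r_i$ arrives it adds, as a function of $r_1,\dots,r_i$ only, finitely many segments to its current solution (which initially consists of the origin alone and from which nothing is ever deleted), subject to the following rules: no point of an added segment lies below the previous request (i.e. has $y$-coordinate smaller than $y_{i-1}$, if $i\ge 2$); each added segment is directed so that $y$ does not decrease and starts at a point that is reachable from the origin by a rectilinear $y$-monotone path in the solution after the additions; and after the additions all of $r_1,\dots,r_i$ are reachable in this way. Let $\mathrm{cost}(A,R)$ denote the cost of the solution that the algorithm $A$ has built after the last request of $R$. **Theorem.** There is an optimal, $O(\sqrt{\log N})$-competitive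 deterministic online algorithm for SRSA, where $N$ is the number of terminals. That is: 1. There are a deterministic online algorithm $A$ for SRSA (which does not know $N$ or any bound on the coordinates in advance) and a constant $C>0$ such that for every $N\ge 2$ and every instance $R$ with $N$ terminals $$\mathrm{cost}(A,R)\le C\sqrt{\log N}\cdot \mathrm{opt}(R).$$ 2. No deterministic online algorithm does asymptotically better: there is a constant $c>0$ such that for every deterministic online algorithm $B$ for SRSA and every $N\ge 2$ there is an instance $R$ with $N$ terminals, $\mathrm{opt}(R)>0$ and $$\mathrm{cost}(B,R)\ge c\sqrt{\log N}\cdot \mathrm{opt}(R).$$ -/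

import Mathlib

namespace SRSA

/-- Points of the plane: the first coordinate is `x`, the second one is `y` (time). -/
abbrev Point : Type := ℝ × ℝ

/-- A rectilinear segment of the closed positive quadrant, traversed from `src` to `tgt`.
It is vertical (same `x`) or horizontal (same `y`), and is directed so that `y` never decreases;
horizontal segments may be directed either way. -/
structure Seg where
  src : Point
  tgt : Point
  axis : src.1 = tgt.1 ∨ src.2 = tgt.2
  up : src.2 ≤ tgt.2
  src_x_nonneg : 0 ≤ src.1
  tgt_x_nonneg : 0 ≤ tgt.1
  src_y_nonneg : 0 ≤ src.2

/-- The length of a rectilinear segment. -/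
def Seg.length (s : Seg) : ℝ := |s.tgt.1 - s.src.1| + |s.tgt.2 - s.src.2|

/-- The cost of a finite set of segments: the sum of their lengths. -/
def cost (F : Finset Seg) : ℝ := ∑ s ∈ F, s.length

/-- The set of points covered by a finite set of segments. -/
def region (F : Finset Seg) : Set Point := ⋃ s ∈ F, segment ℝ s.src s.tgt

/-- One piece of a rectilinear `y`-monotone path inside `F`: a horizontal or vertical straight
line from `p` to `q`, covered by the segments of `F`, along which `y` does not decrease. -/
def Step (F : Finset Seg) (p q : Point) : Prop :=
  (p.1 = q.1 ∨ p.2 = q.2) ∧ p.2 ≤ q.2 ∧ segment ℝ p q ⊆ region F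

/-- `p` can be reached from the origin by a rectilinear `y`-monotone path inside `F`
(the origin itself is always reached, by the empty path). -/
def Reachable (F : Finset Seg) (p : Point) : Prop :=
  Relation.ReflTransGen (Step F) (0, 0) p

/-- An SRSA instance: an ordered set of terminals in the (closed) positive quadrant whose
`y`-coordinates are nondecreasing. -/
structure IsInstance (R : List Point) : Prop where
  nodup : R.Nodup
  nonneg : ∀ r ∈ R, 0 ≤ r.1 ∧ 0 ≤ r.2
  sorted : R.Pairwise fun r r' => r.2 ≤ r'.2

/-- Feasible (offline) solutions: every terminal is reachable from the origin. -/
def IsFeasible (F : Finset Seg) (R : List Point) : Prop := ∀ r ∈ R, Reachable F r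

/-- The optimal offline cost. -/
noncomputable def opt (R : List Point) : ℝ := sInf {c : ℝ | ∃ F, IsFeasible F R ∧ cost F = c}

/-- A deterministic online strategy: given the list of all requests that have arrived so far
(the last one having just arrived), the finite set of segments that it adds now. -/
abbrev Strategy : Type := List Point → Finset Seg

open Classical in
/-- The solution built by a strategy while it processes the requests of `R` one after another:
all the segments that it added at the arrivals of the first, second, ..., last request. -/
noncomputable def Strategy.solution (A : Strategy) (R : List Point) : Finset Seg :=
  (Finset.range R.length).biUnion fun k => A (R.take (k + 1))

/-- The rules of the online model. When the request `r` arrives after the requests `R`,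
* the segments that are added contain no point below the previous request (that is, no point
  below any of the requests in `R`);
* the segments that are added start at points of the current solution arborescence, that is, at
  points reachable from the origin;
* afterwards `r` (and all earlier requests) must be served.
-/
structure IsOnlineAlgorithm (A : Strategy) : Prop where
  no_past : ∀ R r, IsInstance (R ++ [r]) → ∀ s ∈ A (R ++ [r]), ∀ q ∈ R, q.2 ≤ s.src.2
  attached : ∀ R r, IsInstance (R ++ [r]) → ∀ s ∈ A (R ++ [r]),
    Reachable (A.solution (R ++ [r])) s.src
  serves : ∀ R r, IsInstance (R ++ [r]) → IsFeasible (A.solution (R ++ [r])) (R ++ [r])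

/-- `A` is `ρ(N)`-competitive, where `N ≥ 2` is the number of terminals. -/
def IsCompetitive (A : Strategy) (ρ : ℕ → ℝ) : Prop :=
  ∀ R, IsInstance R → 2 ≤ R.length → cost (A.solution R) ≤ ρ R.length * opt R

end SRSA

/-! Lengths are measured by one-dimensional Hausdorff measure: the cost of a solution dominates the
measure of its region, a set that projects onto an interval has at least the length of that
interval, and lengths in disjoint boxes add up.

Lower bound (`exists_stage`, `exists_stages`, `exists_hard_instance`). Let s be about √log N and k =
s². Stage l of the adversary leads from height 2^l to 2^(l+1), over cells of width 6s·2^(l+1). A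
request in column 0 freezes the solution below the new height. If half of the cells are occupied in
their middle third, the algorithm has paid 2^k/4 for keeping copies. Otherwise the centres of the
unoccupied cells are requested, and reaching them costs s·2^k/2. Offline, one horizontal line of
length 6s·2^k at height 0 and vertical lines to the requested centres suffice; the latter cost at
most 2^k per stage with a batch. Whatever the number b ≤ s² of such stages, the ratio is at least
s/32.

Upper bound. Requests are grouped into phases in which the rounded values of log log N and of opt
are constant; δ is about √log N. Each request is widened to a horizontal segment whose radius ρ is
its backward distance to the origin and the widened earlier requests of the phase. The sum of the ρ
is at most twice the cost of any solution (`sum_dist_le_cost`). Vertical copies are kept so that a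
position at distance a has one within 4δa, up to a tiny resolution θ; serving therefore costs O(δ)
times the sum of the ρ. The set of copies is irredundant, so each copy other than the one at 0 has a
position z that no other copy hits. By `length_near_copy`, near z there is length δa of an offline
solution F and the widened requests, or length for the whole current strip, or a piece of F of
length a that leads to no later request. Charging the copies to these lengths (`sum_copies_le`)
gives factors O(log N/δ), O(1) and O(1), and δ = √log N balances them against the cost of serving.
The phases add up geometrically (`sum_scales_le`). -/

namespace SRSA
open MeasureTheory Set

/-! ### Segments, regions, and crossings forced by connectedness. -/

lemma mem_segment_horizontal {a b y : ℝ} {w : Point} :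
    w ∈ segment ℝ ((a, y) : Point) (b, y) ↔ w.1 ∈ uIcc a b ∧ w.2 = y := by
  rw [← Prod.image_mk_segment_left, segment_eq_uIcc]
  constructor
  · rintro ⟨x, hx, rfl⟩
    exact ⟨hx, rfl⟩
  · rintro ⟨hx, rfl⟩
    exact ⟨w.1, hx, rfl⟩

lemma mem_segment_vertical {x a b : ℝ} {w : Point} :
    w ∈ segment ℝ ((x, a) : Point) (x, b) ↔ w.2 ∈ uIcc a b ∧ w.1 = x := by
  rw [← Prod.image_mk_segment_right, segment_eq_uIcc]
  constructor
  · rintro ⟨y, hy, rfl⟩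
    exact ⟨hy, rfl⟩
  · rintro ⟨hy, rfl⟩
    exact ⟨w.2, hy, rfl⟩

lemma isCompact_segment (p q : Point) : IsCompact (segment ℝ p q) := by
  rw [segment_eq_image_lineMap]
  exact isCompact_Icc.image (AffineMap.lineMap_continuous)

lemma snd_mem_of_mem_segment {p q w : Point} (h : p.2 ≤ q.2) (hw : w ∈ segment ℝ p q) :
    p.2 ≤ w.2 ∧ w.2 ≤ q.2 := by
  have : w.2 ∈ segment ℝ p.2 q.2 := (Prod.segment_subset p q hw).2
  rwa [segment_eq_Icc h] at this

lemma Seg.length_nonneg (s : Seg) : 0 ≤ s.length := by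
  unfold Seg.length; positivity

lemma cost_nonneg (F : Finset Seg) : 0 ≤ cost F := Finset.sum_nonneg fun s _ => s.length_nonneg

lemma region_mono {F G : Finset Seg} (h : F ⊆ G) : region F ⊆ region G :=
  biUnion_subset_biUnion_left h

lemma mem_region {F : Finset Seg} {w : Point} :
    w ∈ region F ↔ ∃ s ∈ F, w ∈ segment ℝ s.src s.tgt := by simp [region]

lemma isCompact_region (F : Finset Seg) : IsCompact (region F) :=
  F.isCompact_biUnion fun _ _ => isCompact_segment _ _

lemma Step.mono {F G : Finset Seg} (h : F ⊆ G) {p q : Point} (hs : Step F p q) : Step G p q :=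
  ⟨hs.1, hs.2.1, hs.2.2.trans (region_mono h)⟩

lemma Reachable.mono {F G : Finset Seg} (h : F ⊆ G) {p : Point} (hp : Reachable F p) :
    Reachable G p :=
  Relation.ReflTransGen.mono (fun _ _ hs => Step.mono h hs) _ _ hp

lemma Seg.nonneg_of_mem (s : Seg) {w : Point} (hw : w ∈ segment ℝ s.src s.tgt) :
    0 ≤ w.1 ∧ 0 ≤ w.2 := by
  refine ⟨?_, s.src_y_nonneg.trans (snd_mem_of_mem_segment s.up hw).1⟩
  have : w.1 ∈ segment ℝ s.src.1 s.tgt.1 := (Prod.segment_subset _ _ hw).1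
  exact (convex_Ici (0 : ℝ)).segment_subset s.src_x_nonneg s.tgt_x_nonneg this

lemma nonneg_of_mem_region {F : Finset Seg} {w : Point} (hw : w ∈ region F) :
    0 ≤ w.1 ∧ 0 ≤ w.2 := by
  obtain ⟨s, _, hs⟩ := mem_region.1 hw
  exact s.nonneg_of_mem hs

/-- A `y`-monotone rectilinear path contains a closed connected set joining its end points, each
point of which still leads to the end of the path. -/
lemma exists_path {F : Finset Seg} {p r : Point} (h : Relation.ReflTransGen (Step F) p r) :
    ∃ K : Set Point, IsClosed K ∧ IsPreconnected K ∧ p ∈ K ∧ r ∈ K ∧ K ⊆ region F ∪ {r} ∧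
      ∀ w ∈ K, p.2 ≤ w.2 ∧ w.2 ≤ r.2 ∧ Relation.ReflTransGen (Step F) w r := by
  induction h using Relation.ReflTransGen.head_induction_on with
  | refl =>
    refine ⟨{r}, isClosed_singleton, isPreconnected_singleton, rfl, rfl,
      subset_union_right, ?_⟩
    rintro w rfl
    exact ⟨le_rfl, le_rfl, .refl⟩
  | @head p q hpq hqr ih =>
    obtain ⟨K, hc, hconn, hq, hr, hsub, hK⟩ := ih
    refine ⟨segment ℝ p q ∪ K, (isCompact_segment p q).isClosed.union hc,
      IsPreconnected.union q (right_mem_segment ℝ p q) hq (convex_segment p q).isPreconnected hconn,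
      Or.inl (left_mem_segment ℝ p q), Or.inr hr,
      union_subset (hpq.2.2.trans subset_union_left) hsub, ?_⟩
    rintro w (hw | hw)
    · have h1 := snd_mem_of_mem_segment hpq.2.1 hw
      refine ⟨h1.1, h1.2.trans (hK q hq).2.1, .head ⟨?_, h1.2, ?_⟩ hqr⟩
      · rcases hpq.1 with h | h
        · left
          have h2 := (Prod.segment_subset _ _ hw).1
          rw [h, segment_same] at h2
          exact h2
        · right
          exact le_antisymm h1.2 (h ▸ h1.1)
      · exact ((convex_segment p q).segment_subset hw (right_mem_segment ℝ p q)).trans hpq.2.2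
    · exact ⟨hpq.2.1.trans (hK w hw).1, (hK w hw).2⟩

/-- A connected set that enters the strip above the height `h` between the columns `x₁` and `x₂`
without crossing these columns above that height has to cross the height `h`. -/
lemma exists_crossing_below {K : Set Point} (hK : IsPreconnected K) {r o : Point} {x₁ x₂ h : ℝ}
    (hr : r ∈ K) (ho : o ∈ K) (hr₁ : x₁ < r.1) (hr₂ : r.1 < x₂) (hrh : h < r.2)
    (ho' : o.1 < x₁ ∨ x₂ < o.1 ∨ o.2 < h)
    (hcol : ∀ w ∈ K, h ≤ w.2 → w.1 ≠ x₁ ∧ w.1 ≠ x₂) :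
    ∃ w ∈ K, w.2 = h ∧ x₁ < w.1 ∧ w.1 < x₂ := by
  by_contra! hno
  -- If the height is never crossed between the columns, the open strip above it and the open
  -- outside separate `r` from `o` within `K`.
  have hU : IsOpen {w : Point | x₁ < w.1 ∧ w.1 < x₂ ∧ h < w.2} :=
    (isOpen_lt continuous_const continuous_fst).inter
      ((isOpen_lt continuous_fst continuous_const).inter
        (isOpen_lt continuous_const continuous_snd))
  have hV : IsOpen {w : Point | w.1 < x₁ ∨ x₂ < w.1 ∨ w.2 < h} :=
    (isOpen_lt continuous_fst continuous_const).union
      ((isOpen_lt continuous_const continuous_fst).union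
        (isOpen_lt continuous_snd continuous_const))
  obtain ⟨w, -, ⟨h1, h2, h3⟩, h4⟩ := hK _ _ hU hV (by
    intro w hw
    by_cases hwh : w.2 < h
    · exact Or.inr (Or.inr (Or.inr hwh))
    push Not at hwh
    obtain ⟨h1, h2⟩ := hcol w hw hwh
    rcases lt_or_gt_of_ne h1 with h1 | h1
    · exact Or.inr (Or.inl h1)
    rcases lt_or_gt_of_ne h2 with h2 | h2
    · rcases hwh.lt_or_eq with h3 | h3
      · exact Or.inl ⟨h1, h2, h3⟩
      · exact absurd h2 (not_lt.2 (hno w hw h3.symm h1))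
    · exact Or.inr (Or.inr (Or.inl h2))) ⟨r, hr, hr₁, hr₂, hrh⟩ ⟨o, ho, ho'⟩
  rcases h4 with h4 | h4 | h4 <;> linarith

lemma exists_crossing_above {K : Set Point} (hK : IsPreconnected K) {r o : Point} {x₁ x₂ h : ℝ}
    (hr : r ∈ K) (ho : o ∈ K) (hr₁ : x₁ < r.1) (hr₂ : r.1 < x₂) (hrh : r.2 < h)
    (ho' : o.1 < x₁ ∨ x₂ < o.1 ∨ h < o.2)
    (hcol : ∀ w ∈ K, w.2 ≤ h → w.1 ≠ x₁ ∧ w.1 ≠ x₂) :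
    ∃ w ∈ K, w.2 = h ∧ x₁ < w.1 ∧ w.1 < x₂ := by
  have hcont : Continuous fun w : Point => ((w.1, -w.2) : Point) := by fun_prop
  obtain ⟨_, ⟨w, hw, rfl⟩, h1, h2, h3⟩ :=
    exists_crossing_below (hK.image _ hcont.continuousOn) (mem_image_of_mem _ hr)
      (mem_image_of_mem _ ho) (x₁ := x₁) (x₂ := x₂) (h := -h) hr₁ hr₂ (neg_lt_neg hrh)
      (by simpa using ho') (by
        rintro _ ⟨w, hw, rfl⟩ h1
        exact hcol w hw (neg_le_neg_iff.1 h1))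
  exact ⟨w, hw, neg_inj.1 h1, h2, h3⟩

/-! ### Hausdorff length and its relation to cost. -/

/-- Coordinate projections are 1-Lipschitz. Read contrapositively, a set of small length misses some
height; this is how free heights and columns are found below. -/
lemma ofReal_le_hausdorffMeasure_of_snd {A : Set Point} {a b : ℝ}
    (h : ∀ t ∈ Ioo a b, ∃ w ∈ A, w.2 = t) : ENNReal.ofReal (b - a) ≤ μH[1] A := by
  rw [← Real.volume_Ioo, ← hausdorffMeasure_real]
  have h1 := (LipschitzWith.prod_snd (α := ℝ) (β := ℝ)).hausdorffMeasure_image_le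
    (d := 1) zero_le_one A
  simp only [ENNReal.coe_one, ENNReal.one_rpow, one_mul] at h1
  refine (measure_mono fun t ht => ?_).trans h1
  obtain ⟨w, hw, rfl⟩ := h t ht
  exact mem_image_of_mem _ hw

lemma ofReal_le_hausdorffMeasure_of_fst {A : Set Point} {a b : ℝ}
    (h : ∀ t ∈ Ioo a b, ∃ w ∈ A, w.1 = t) : ENNReal.ofReal (b - a) ≤ μH[1] A := by
  rw [← Real.volume_Ioo, ← hausdorffMeasure_real]
  have h1 := (LipschitzWith.prod_fst (α := ℝ) (β := ℝ)).hausdorffMeasure_image_le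
    (d := 1) zero_le_one A
  simp only [ENNReal.coe_one, ENNReal.one_rpow, one_mul] at h1
  refine (measure_mono fun t ht => ?_).trans h1
  obtain ⟨w, hw, rfl⟩ := h t ht
  exact mem_image_of_mem _ hw

lemma hausdorffMeasure_segment_le (p q : Point) :
    μH[1] (segment ℝ p q) ≤ ENNReal.ofReal (|q.1 - p.1| + |q.2 - p.2|) := by
  rw [hausdorffMeasure_segment, edist_dist]
  refine ENNReal.ofReal_le_ofReal ?_
  rw [Prod.dist_eq, dist_comm p.1, dist_comm p.2, Real.dist_eq, Real.dist_eq]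
  exact max_le_add_of_nonneg (abs_nonneg _) (abs_nonneg _)

/-- Overlaps and the sup metric can only lower the measure, which suffices because the measure
serves only to bound costs from below. -/
lemma hausdorffMeasure_region_le (F : Finset Seg) :
    μH[1] (region F) ≤ ENNReal.ofReal (cost F) := by
  rw [cost, ENNReal.ofReal_sum_of_nonneg fun s _ => s.length_nonneg]
  exact (measure_biUnion_finset_le _ _).trans
    (Finset.sum_le_sum fun s _ => hausdorffMeasure_segment_le _ _)

/-- Local estimates in disjoint boxes become a global one. -/
lemma sum_le_hausdorffMeasure {ι : Type*} {A : Set Point} (hA : MeasurableSet A) (E : Finset ι)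
    (B : ι → Set Point) (v : ι → ENNReal) (hB : ∀ e ∈ E, MeasurableSet (B e))
    (hd : (E : Set ι).PairwiseDisjoint B) (h : ∀ e ∈ E, v e ≤ μH[1] (A ∩ B e)) :
    ∑ e ∈ E, v e ≤ μH[1] A :=
  calc ∑ e ∈ E, v e ≤ ∑ e ∈ E, μH[1] (A ∩ B e) := Finset.sum_le_sum h
    _ = μH[1] (⋃ e ∈ E, A ∩ B e) :=
        (measure_biUnion_finset (hd.mono fun _ => inter_subset_right) fun e he =>
          hA.inter (hB e he)).symm
    _ ≤ μH[1] A := measure_mono (iUnion₂_subset fun _ _ => inter_subset_left)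

lemma Reachable.fst_le_cost {F : Finset Seg} {r : Point} (h : Reachable F r) : r.1 ≤ cost F := by
  obtain ⟨K, -, hK, h0, hr, hsub, -⟩ := exists_path h
  have h1 := (hK.image _ continuous_fst.continuousOn).ordConnected.out
    (mem_image_of_mem _ h0) (mem_image_of_mem _ hr)
  have h2 : ENNReal.ofReal (r.1 - 0) ≤ μH[1] (region F) :=
    ofReal_le_hausdorffMeasure_of_fst fun t ht => by
      obtain ⟨w, hw, rfl⟩ := h1 ⟨ht.1.le, ht.2.le⟩
      rcases hsub hw with h3 | rfl
      · exact ⟨w, h3, rfl⟩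
      · exact absurd ht.2 (lt_irrefl _)
  have h3 := h2.trans (hausdorffMeasure_region_le F)
  rw [ENNReal.ofReal_le_ofReal_iff (cost_nonneg F)] at h3
  linarith

lemma Reachable.snd_le_cost {F : Finset Seg} {r : Point} (h : Reachable F r) : r.2 ≤ cost F := by
  obtain ⟨K, -, hK, h0, hr, hsub, -⟩ := exists_path h
  have h1 := (hK.image _ continuous_snd.continuousOn).ordConnected.out
    (mem_image_of_mem _ h0) (mem_image_of_mem _ hr)
  have h2 : ENNReal.ofReal (r.2 - 0) ≤ μH[1] (region F) :=
    ofReal_le_hausdorffMeasure_of_snd fun t ht => by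
      obtain ⟨w, hw, rfl⟩ := h1 ⟨ht.1.le, ht.2.le⟩
      rcases hsub hw with h3 | rfl
      · exact ⟨w, h3, rfl⟩
      · exact absurd ht.2 (lt_irrefl _)
  have h3 := h2.trans (hausdorffMeasure_region_le F)
  rw [ENNReal.ofReal_le_ofReal_iff (cost_nonneg F)] at h3
  linarith

/-! ### The optimal cost, explicit segments, and solutions of online strategies. -/

lemma bddBelow_costs (R : List Point) : BddBelow {c : ℝ | ∃ F, IsFeasible F R ∧ cost F = c} :=
  ⟨0, by rintro _ ⟨F, -, rfl⟩; exact cost_nonneg F⟩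

lemma opt_le_cost {F : Finset Seg} {R : List Point} (h : IsFeasible F R) : opt R ≤ cost F :=
  csInf_le (bddBelow_costs R) ⟨F, h, rfl⟩

lemma opt_nonneg (R : List Point) : 0 ≤ opt R :=
  Real.sInf_nonneg (by rintro _ ⟨F, -, rfl⟩; exact cost_nonneg F)

open Classical in
/-- The segment from `p` to `q`, if this is an admissible one, and a degenerate segment at the
origin otherwise. -/
noncomputable def mkSeg (p q : Point) : Seg :=
  if h : (p.1 = q.1 ∨ p.2 = q.2) ∧ p.2 ≤ q.2 ∧ 0 ≤ p.1 ∧ 0 ≤ q.1 ∧ 0 ≤ p.2 then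
    ⟨p, q, h.1, h.2.1, h.2.2.1, h.2.2.2.1, h.2.2.2.2⟩
  else ⟨(0, 0), (0, 0), Or.inl rfl, le_rfl, le_rfl, le_rfl, le_rfl⟩

lemma mkSeg_vertical {x a b : ℝ} (hx : 0 ≤ x) (ha : 0 ≤ a) (hab : a ≤ b) :
    (mkSeg (x, a) (x, b)).src = (x, a) ∧ (mkSeg (x, a) (x, b)).tgt = (x, b) ∧
      (mkSeg (x, a) (x, b)).length = b - a := by
  have h : ((x, a) : Point).1 = ((x, b) : Point).1 ∨ ((x, a) : Point).2 = ((x, b) : Point).2 :=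
    Or.inl rfl
  rw [mkSeg, dif_pos ⟨h, hab, hx, hx, ha⟩]
  refine ⟨rfl, rfl, ?_⟩
  simp [Seg.length, abs_of_nonneg (sub_nonneg.2 hab)]

lemma mkSeg_horizontal {y a b : ℝ} (hy : 0 ≤ y) (ha : 0 ≤ a) (hb : 0 ≤ b) :
    (mkSeg (a, y) (b, y)).src = (a, y) ∧ (mkSeg (a, y) (b, y)).tgt = (b, y) ∧
      (mkSeg (a, y) (b, y)).length = |b - a| := by
  have h : ((a, y) : Point).1 = ((b, y) : Point).1 ∨ ((a, y) : Point).2 = ((b, y) : Point).2 :=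
    Or.inr rfl
  rw [mkSeg, dif_pos ⟨h, le_rfl, ha, hb, hy⟩]
  refine ⟨rfl, rfl, ?_⟩
  simp [Seg.length]

lemma step_vertical {F : Finset Seg} {x a b c : ℝ} (hx : 0 ≤ x) (ha : 0 ≤ a) (hab : a ≤ b)
    (hbc : b ≤ c) (h : mkSeg (x, a) (x, c) ∈ F) : Step F (x, a) (x, b) := by
  refine ⟨Or.inl rfl, hab, fun w hw => mem_region.2 ⟨_, h, ?_⟩⟩
  rw [(mkSeg_vertical hx ha (hab.trans hbc)).1, (mkSeg_vertical hx ha (hab.trans hbc)).2.1,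
    mem_segment_vertical, uIcc_of_le (hab.trans hbc)]
  rw [mem_segment_vertical, uIcc_of_le hab] at hw
  exact ⟨⟨hw.1.1, hw.1.2.trans hbc⟩, hw.2⟩

lemma step_horizontal {F : Finset Seg} {y a b c : ℝ} (hy : 0 ≤ y) (ha : 0 ≤ a) (hc : 0 ≤ c)
    (hb : b ∈ uIcc a c) (h : mkSeg (a, y) (c, y) ∈ F) : Step F (a, y) (b, y) := by
  refine ⟨Or.inr rfl, le_rfl, fun w hw => mem_region.2 ⟨_, h, ?_⟩⟩
  rw [(mkSeg_horizontal hy ha hc).1, (mkSeg_horizontal hy ha hc).2.1, mem_segment_horizontal]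
  rw [mem_segment_horizontal] at hw
  exact ⟨uIcc_subset_uIcc left_mem_uIcc hb hw.1, hw.2⟩

lemma exists_isFeasible {R : List Point} (h : ∀ r ∈ R, 0 ≤ r.1 ∧ 0 ≤ r.2) :
    ∃ F, IsFeasible F R := by
  classical
  refine ⟨R.toFinset.image (fun r => mkSeg (0, 0) (0, r.2)) ∪
    R.toFinset.image (fun r => mkSeg (0, r.2) (r.1, r.2)), fun r hr => ?_⟩
  have h1 := h r hr
  refine .tail (.single (step_vertical le_rfl le_rfl h1.2 le_rfl ?_))
    (step_horizontal h1.2 le_rfl h1.1 (b := r.1) right_mem_uIcc ?_)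
  · exact Finset.mem_union_left _ (Finset.mem_image_of_mem _ (List.mem_toFinset.2 hr))
  · exact Finset.mem_union_right _
      (Finset.mem_image_of_mem (fun r : Point => mkSeg (0, r.2) (r.1, r.2))
        (List.mem_toFinset.2 hr))

lemma nonempty_costs {R : List Point} (h : ∀ r ∈ R, 0 ≤ r.1 ∧ 0 ≤ r.2) :
    {c : ℝ | ∃ F, IsFeasible F R ∧ cost F = c}.Nonempty := by
  obtain ⟨F, hF⟩ := exists_isFeasible h
  exact ⟨_, F, hF, rfl⟩

lemma fst_le_opt {R : List Point} (h : ∀ r ∈ R, 0 ≤ r.1 ∧ 0 ≤ r.2) {r : Point} (hr : r ∈ R) :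
    r.1 ≤ opt R :=
  le_csInf (nonempty_costs h) (by rintro _ ⟨F, hF, rfl⟩; exact (hF r hr).fst_le_cost)

lemma snd_le_opt {R : List Point} (h : ∀ r ∈ R, 0 ≤ r.1 ∧ 0 ≤ r.2) {r : Point} (hr : r ∈ R) :
    r.2 ≤ opt R :=
  le_csInf (nonempty_costs h) (by rintro _ ⟨F, hF, rfl⟩; exact (hF r hr).snd_le_cost)

lemma opt_mono {R R' : List Point} (h : ∀ r ∈ R', 0 ≤ r.1 ∧ 0 ≤ r.2) (hs : R ⊆ R') :
    opt R ≤ opt R' :=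
  le_csInf (nonempty_costs h) (by
    rintro _ ⟨F, hF, rfl⟩
    exact opt_le_cost fun r hr => hF r (hs hr))

lemma exists_feasible_cost_lt {R : List Point} (h : ∀ r ∈ R, 0 ≤ r.1 ∧ 0 ≤ r.2) {c : ℝ}
    (hc : opt R < c) : ∃ F, IsFeasible F R ∧ cost F < c := by
  obtain ⟨_, ⟨F, hF, rfl⟩, h1⟩ := exists_lt_of_csInf_lt (nonempty_costs h) hc
  exact ⟨F, hF, h1⟩

lemma IsInstance.of_append {R T : List Point} (h : IsInstance (R ++ T)) : IsInstance R :=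
  ⟨h.nodup.of_append_left, fun r hr => h.nonneg r (List.mem_append_left _ hr),
    (List.pairwise_append.1 h.sorted).1⟩

open Classical in
lemma Strategy.solution_append_singleton (A : Strategy) (R : List Point) (r : Point) :
    A.solution (R ++ [r]) = A.solution R ∪ A (R ++ [r]) := by
  unfold Strategy.solution
  ext s
  simp only [List.length_append, List.length_singleton, Finset.mem_biUnion, Finset.mem_range,
    Finset.mem_union]
  constructor
  · rintro ⟨k, hk, hs⟩
    rcases Nat.lt_succ_iff_lt_or_eq.1 hk with hk | rfl
    · refine Or.inl ⟨k, hk, ?_⟩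
      rwa [List.take_append_of_le_length (by omega)] at hs
    · refine Or.inr ?_
      rwa [List.take_of_length_le (by simp)] at hs
  · rintro (⟨k, hk, hs⟩ | hs)
    · exact ⟨k, by omega, by rwa [List.take_append_of_le_length (by omega)]⟩
    · exact ⟨R.length, by omega, by rwa [List.take_of_length_le (by simp)]⟩

lemma Strategy.solution_subset_append (A : Strategy) (R T : List Point) :
    A.solution R ⊆ A.solution (R ++ T) := by
  classical
  intro s hs
  simp only [Strategy.solution, Finset.mem_biUnion, Finset.mem_range] at hs ⊢
  obtain ⟨k, hk, hs⟩ := hs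
  exact ⟨k, by rw [List.length_append]; omega,
    by rwa [List.take_append_of_le_length (by omega)]⟩

lemma IsInstance.take {R : List Point} (h : IsInstance R) (k : ℕ) : IsInstance (R.take k) := by
  rw [← List.take_append_drop k R] at h
  exact h.of_append

lemma Strategy.mem_solution {A : Strategy} {R : List Point} {s : Seg} :
    s ∈ A.solution R ↔ ∃ k < R.length, s ∈ A (R.take (k + 1)) := by
  simp [Strategy.solution]

lemma Strategy.solution_take_subset (A : Strategy) (R : List Point) (k : ℕ) :
    A.solution (R.take k) ⊆ A.solution R := by
  conv_rhs => rw [← List.take_append_drop k R]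
  exact A.solution_subset_append _ _

/-- Every point of the solution of an online algorithm is reachable. -/
lemma IsOnlineAlgorithm.reachable {B : Strategy} (hB : IsOnlineAlgorithm B) {R : List Point}
    (hR : IsInstance R) {q : Point} (hq : q ∈ region (B.solution R)) :
    Reachable (B.solution R) q := by
  obtain ⟨s, hs, hqs⟩ := mem_region.1 hq
  obtain ⟨k, hk, hsk⟩ := Strategy.mem_solution.1 hs
  have h1 : R.take (k + 1) = R.take k ++ [R[k]] := (List.take_append_getElem hk).symm
  have h2 := hB.attached (R.take k) R[k] (h1 ▸ hR.take _) s (h1 ▸ hsk)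
  rw [← h1] at h2
  have h3 := snd_mem_of_mem_segment s.up hqs
  refine (h2.mono (B.solution_take_subset R _)).tail ⟨?_, h3.1, ?_⟩
  · rcases s.axis with h | h
    · left
      have h4 := (Prod.segment_subset _ _ hqs).1
      rw [h, segment_same] at h4
      exact h.trans h4.symm
    · exact Or.inr (le_antisymm h3.1 (h ▸ h3.2))
  · exact fun w hw => mem_region.2 ⟨s, hs,
      (convex_segment _ _).segment_subset (left_mem_segment ℝ _ _) hqs hw⟩

/-- Below the height of a request `q`, the solution does not change after the arrival of `q`. -/
lemma IsOnlineAlgorithm.mem_region_of_lt {B : Strategy} (hB : IsOnlineAlgorithm B)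
    {R T : List Point} (hR : IsInstance (R ++ T)) {q w : Point} (hq : q ∈ R)
    (hw : w ∈ region (B.solution (R ++ T))) (hlt : w.2 < q.2) : w ∈ region (B.solution R) := by
  obtain ⟨s, hs, hws⟩ := mem_region.1 hw
  refine mem_region.2 ⟨s, ?_, hws⟩
  obtain ⟨k, hk, hsk⟩ := Strategy.mem_solution.1 hs
  by_cases hkR : k < R.length
  · exact Strategy.mem_solution.2
      ⟨k, hkR, by rwa [List.take_append_of_le_length (by omega)] at hsk⟩
  exfalso
  have h1 : (R ++ T).take (k + 1) = (R ++ T).take k ++ [(R ++ T)[k]] :=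
    (List.take_append_getElem hk).symm
  have h2 : q ∈ (R ++ T).take k := by
    rw [List.take_append]
    refine List.mem_append_left _ ?_
    rwa [List.take_of_length_le (by omega)]
  have h3 := hB.no_past _ _ (h1 ▸ hR.take _) s (h1 ▸ hsk) q h2
  have h4 := (snd_mem_of_mem_segment s.up hws).1
  linarith

/-! ### Lower bound: length forced in one cell, and the adversary. -/

/-- A path to `q` either climbs the whole strip inside the cell or crosses one of its side margins.
With less length than `v`, a height and a column in each margin would be free, and they would cut
`q` off from the origin. -/
lemma ofReal_le_of_reachable {F : Finset Seg} {q : Point} (hq : Reachable F q)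
    {a a' b' b t₀ v : ℝ} (ht₀ : 0 ≤ t₀) (haq : a' ≤ q.1) (hqb : q.1 ≤ b')
    (hv : v ≤ q.2 - t₀) (hva : v ≤ a' - a) (hvb : v ≤ b - b') :
    ENNReal.ofReal v ≤ μH[1] (region F ∩ (Ico a b ×ˢ Ioc t₀ q.2)) := by
  obtain ⟨K, -, hK, h0, hqK, hsub, hKw⟩ := exists_path hq
  by_contra hlt
  have hy : ∃ h ∈ Ioo t₀ q.2, ∀ w ∈ region F ∩ (Ico a b ×ˢ Ioc t₀ q.2), w.2 ≠ h := by
    by_contra! hcon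
    exact hlt ((ENNReal.ofReal_le_ofReal hv).trans (ofReal_le_hausdorffMeasure_of_snd hcon))
  have hx₁ : ∃ x ∈ Ioo a a', ∀ w ∈ region F ∩ (Ico a b ×ˢ Ioc t₀ q.2), w.1 ≠ x := by
    by_contra! hcon
    exact hlt ((ENNReal.ofReal_le_ofReal hva).trans (ofReal_le_hausdorffMeasure_of_fst hcon))
  have hx₂ : ∃ x ∈ Ioo b' b, ∀ w ∈ region F ∩ (Ico a b ×ˢ Ioc t₀ q.2), w.1 ≠ x := by
    by_contra! hcon
    exact hlt ((ENNReal.ofReal_le_ofReal hvb).trans (ofReal_le_hausdorffMeasure_of_fst hcon))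
  obtain ⟨h, hh, hy⟩ := hy
  obtain ⟨x₁, hx₁, hw₁⟩ := hx₁
  obtain ⟨x₂, hx₂, hw₂⟩ := hx₂
  have hbox : ∀ w ∈ K, h ≤ w.2 → x₁ ≤ w.1 → w.1 ≤ x₂ → w ≠ q →
      w ∈ region F ∩ (Ico a b ×ˢ Ioc t₀ q.2) := by
    intro w hw h1 h2 h3 h4
    rcases hsub hw with h5 | h5
    · exact ⟨h5, ⟨hx₁.1.le.trans h2, h3.trans_lt hx₂.2⟩, hh.1.trans_le h1, (hKw w hw).2.1⟩
    · exact absurd h5 h4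
  obtain ⟨w, hw, h1, h2, h3⟩ := exists_crossing_below hK (x₁ := x₁) (x₂ := x₂) (h := h) hqK h0
    (hx₁.2.trans_le haq) (hqb.trans_lt hx₂.1) hh.2 (Or.inr (Or.inr (ht₀.trans_lt hh.1))) (by
      intro w hw hhw
      have hx : x₁ ≤ x₂ := by linarith [hx₁.2, hx₂.1]
      constructor
      · rintro h5
        refine hw₁ w (hbox w hw hhw h5.ge (h5.trans_le hx) ?_) h5
        rintro rfl
        linarith [hx₁.2]
      · rintro h5
        refine hw₂ w (hbox w hw hhw (hx.trans_eq h5.symm) h5.le ?_) h5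
        rintro rfl
        linarith [hx₂.1])
  refine hy w (hbox w hw h1.ge h2.le h3.le ?_) h1
  rintro rfl
  exact absurd h1 hh.2.ne'

/-- The earlier request `q` at the height of `c` rules out later additions below that height. A
window of the cell that is empty at this height when `R` has been served must therefore be crossed
horizontally from one of its ends to `c`. -/
lemma ofReal_le_of_unreached {B : Strategy} (hB : IsOnlineAlgorithm B) {R T : List Point}
    (hR : IsInstance (R ++ T)) {q c : Point} (hq : q ∈ R) (hqc : q.2 = c.2) (hc : c ∈ R ++ T)
    {a a' b' b t₀ v : ℝ} (ht₀ : 0 ≤ t₀) (htc : t₀ < c.2) (ha : a ≤ a') (hb : b' ≤ b)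
    (hun : ∀ w ∈ region (B.solution R), w.2 = c.2 → ¬ (a' ≤ w.1 ∧ w.1 ≤ b'))
    (hva : v ≤ c.1 - a') (hvb : v ≤ b' - c.1) :
    ENNReal.ofReal v ≤
      μH[1] (region (B.solution (R ++ T)) ∩ (Ico a b ×ˢ Ioc t₀ c.2)) := by
  have hreach : Reachable (B.solution (R ++ T)) c := by
    rcases List.eq_nil_or_concat (R ++ T) with h | ⟨R', r, h⟩
    · simp [h] at hc
    · rw [List.concat_eq_append] at h
      rw [h] at hR hc ⊢
      exact hB.serves _ _ hR c hc
  set F := B.solution (R ++ T) with hF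
  obtain ⟨K, -, hK, h0, hcK, hsub, hKw⟩ := exists_path hreach
  by_contra hlt
  have hx₁ : ∃ x ∈ Ioo a' c.1, ∀ w ∈ region F ∩ (Ico a b ×ˢ Ioc t₀ c.2), w.1 ≠ x := by
    by_contra! hcon
    exact hlt ((ENNReal.ofReal_le_ofReal hva).trans (ofReal_le_hausdorffMeasure_of_fst hcon))
  have hx₂ : ∃ x ∈ Ioo c.1 b', ∀ w ∈ region F ∩ (Ico a b ×ˢ Ioc t₀ c.2), w.1 ≠ x := by
    by_contra! hcon
    exact hlt ((ENNReal.ofReal_le_ofReal hvb).trans (ofReal_le_hausdorffMeasure_of_fst hcon))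
  obtain ⟨x₁, hx₁, hw₁⟩ := hx₁
  obtain ⟨x₂, hx₂, hw₂⟩ := hx₂
  have hcol : ∀ w ∈ K, t₀ < w.2 → w.1 ≠ x₁ ∧ w.1 ≠ x₂ := by
    intro w hw hhw
    have hbox : x₁ ≤ w.1 → w.1 ≤ x₂ → w ≠ c →
        w ∈ region F ∩ (Ico a b ×ˢ Ioc t₀ c.2) := by
      intro h2 h3 h4
      rcases hsub hw with h5 | h5
      · exact ⟨h5, ⟨by linarith [hx₁.1], by linarith [hx₂.2]⟩, hhw, (hKw w hw).2.1⟩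
      · exact absurd h5 h4
    have hx : x₁ ≤ x₂ := by linarith [hx₁.2, hx₂.1]
    constructor
    · rintro h5
      refine hw₁ w (hbox h5.ge (h5.trans_le hx) ?_) h5
      rintro rfl
      linarith [hx₁.2]
    · rintro h5
      refine hw₂ w (hbox (hx.trans_eq h5.symm) h5.le ?_) h5
      rintro rfl
      linarith [hx₂.1]
  -- With two free columns the path to `c` stays between them, and its part below `c` already
  -- belongs to the solution for `R`.
  have hcross : Ioo t₀ c.2 ⊆
      Prod.snd '' (region (B.solution R) ∩ {w : Point | x₁ ≤ w.1 ∧ w.1 ≤ x₂}) := by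
    intro h hh
    obtain ⟨w, hw, h1, h2, h3⟩ := exists_crossing_below hK (x₁ := x₁) (x₂ := x₂) (h := h) hcK h0
      hx₁.2 hx₂.1 hh.2 (Or.inr (Or.inr (ht₀.trans_lt hh.1)))
      fun w hw hhw => hcol w hw (hh.1.trans_le hhw)
    refine ⟨w, ⟨?_, h2.le, h3.le⟩, h1⟩
    refine hB.mem_region_of_lt hR hq ?_ (by rw [hqc, h1]; exact hh.2)
    rcases hsub hw with h5 | h5
    · exact h5
    · rw [mem_singleton_iff] at h5
      rw [h5] at h1
      exact absurd h1 hh.2.ne'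
  -- Compactness passes from heights just below `c.2` to `c.2` itself, where the window was assumed
  -- to be empty.
  have hclosed : IsClosed (Prod.snd '' (region (B.solution R) ∩
      {w : Point | x₁ ≤ w.1 ∧ w.1 ≤ x₂})) :=
    (((isCompact_region _).inter_right ((isClosed_le continuous_const continuous_fst).inter
      (isClosed_le continuous_fst continuous_const))).image continuous_snd).isClosed
  have h1 := closure_minimal hcross hclosed
  rw [closure_Ioo htc.ne] at h1
  obtain ⟨w, ⟨hw, h2, h3⟩, h4⟩ := h1 (right_mem_Icc.2 htc.le)
  exact hun w hw h4 ⟨by linarith [hx₁.1], by linarith [hx₂.2]⟩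

lemma region_inter_measurableSet (F : Finset Seg) {B : Set Point} (hB : MeasurableSet B) :
    MeasurableSet (region F ∩ B) := (isCompact_region F).measurableSet.inter hB

lemma pairwiseDisjoint_cells {w : ℝ} (hw : 0 < w) (I : Set ℝ) (E : Set ℕ) :
    E.PairwiseDisjoint fun i : ℕ => (Ico (i * w) ((i + 1) * w)) ×ˢ I := by
  intro i _ j _ hij
  refine Set.disjoint_left.2 fun p hp hp' => hij ?_
  have h1 : (i : ℝ) * w < (j + 1) * w := hp.1.1.trans_lt hp'.1.2
  have h2 : (j : ℝ) * w < (i + 1) * w := hp'.1.1.trans_lt hp.1.2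
  have h3 : (i : ℝ) < j + 1 := lt_of_mul_lt_mul_right h1 hw.le
  have h4 : (j : ℝ) < i + 1 := lt_of_mul_lt_mul_right h2 hw.le
  norm_cast at h3 h4
  omega

/-- One stage of the adversary: it waits from the height `t₀` to the height `t`, and then either the
algorithm has kept copies in half of the `m` cells of width `w` or it does not have copies in
the middle thirds of half of the cells, and is asked for the centers of these. -/
lemma exists_stage {B : Strategy} (hB : IsOnlineAlgorithm B) {R : List Point} (hR : IsInstance R)
    {t₀ t w : ℝ} (ht₀ : 0 ≤ t₀) (hlt : t₀ < t) (hw : 0 < w) (hwt : 3 * (t - t₀) ≤ w)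
    (hRt : ∀ r ∈ R, r.2 ≤ t₀) (m : ℕ) :
    ∃ S : List Point, IsInstance (R ++ S) ∧ S.length ≤ m + 1 ∧ ∃ Z : List Point,
      (∀ r ∈ S, r = (0, t) ∨ r ∈ Z) ∧ (∀ r ∈ Z, r.2 = t ∧ 0 ≤ r.1 ∧ r.1 ≤ m * w) ∧
      ((Z = [] ∧ ∀ T, IsInstance (R ++ S ++ T) → ENNReal.ofReal (m / 2 * (t - t₀)) ≤
          μH[1] (region (B.solution (R ++ S ++ T)) ∩ {p | t₀ < p.2 ∧ p.2 ≤ t})) ∨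
       (Z.length ≤ m ∧ ∀ T, IsInstance (R ++ S ++ T) → ENNReal.ofReal (m / 2 * (w / 6)) ≤
          μH[1] (region (B.solution (R ++ S ++ T)) ∩ {p | t₀ < p.2 ∧ p.2 ≤ t}))) := by
  classical
  have hband : MeasurableSet {p : Point | t₀ < p.2 ∧ p.2 ≤ t} :=
    (measurableSet_lt measurable_const measurable_snd).inter
      (measurableSet_le measurable_snd measurable_const)
  -- The waiting request freezes the strip below `t`; offline it only needs column 0.
  have hwait : IsInstance (R ++ [(0, t)]) := by
    refine ⟨?_, ?_, ?_⟩
    · refine List.nodup_append.2 ⟨hR.nodup, List.nodup_singleton _, ?_⟩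
      intro a ha b hb hab
      rw [List.mem_singleton] at hb
      have := hRt a ha
      rw [hab, hb] at this
      exact absurd this (not_le.2 hlt)
    · intro r hr
      rcases List.mem_append.1 hr with h | h
      · exact hR.nonneg r h
      · rw [List.mem_singleton] at h
        rw [h]
        exact ⟨le_rfl, ht₀.trans hlt.le⟩
    · refine List.pairwise_append.2 ⟨hR.sorted, List.pairwise_singleton _ _, ?_⟩
      intro a ha b hb
      rw [List.mem_singleton] at hb
      rw [hb]
      exact (hRt a ha).trans hlt.le
  -- Middle thirds leave a margin `w / 3 ≥ t - t₀` on both sides of a hit, and a free distance `w /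
  -- 6` on both sides of the centre of a cell without one.
  set hit : ℕ → Prop := fun i => ∃ p ∈ region (B.solution (R ++ [(0, t)])), p.2 = t ∧
    i * w + w / 3 ≤ p.1 ∧ p.1 ≤ i * w + 2 * w / 3 with hhit
  set H := (Finset.range m).filter hit
  set U := (Finset.range m).filter fun i => ¬ hit i
  have hcard : H.card + U.card = m := by
    have := Finset.card_filter_add_card_filter_not (s := Finset.range m) hit
    rwa [Finset.card_range] at this
  have hmeas : ∀ (E : Finset ℕ), ∀ i ∈ E,
      MeasurableSet ((Ico ((i : ℝ) * w) ((i + 1) * w)) ×ˢ Ioc t₀ t) :=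
    fun E i _ => measurableSet_Ico.prod measurableSet_Ioc
  have hsubset : ∀ F : Finset Seg, ∀ i : ℕ, region F ∩ (Ico ((i : ℝ) * w) ((i + 1) * w) ×ˢ Ioc t₀ t)
      ⊆ region F ∩ {p : Point | t₀ < p.2 ∧ p.2 ≤ t} ∩
        (Ico ((i : ℝ) * w) ((i + 1) * w) ×ˢ Ioc t₀ t) :=
    fun F i p hp => ⟨⟨hp.1, hp.2.2⟩, hp.2⟩
  rcases le_or_gt m (2 * H.card) with hgood | hbad
  · refine ⟨[(0, t)], hwait, by simp, [], by simp, by simp, Or.inl ⟨rfl, fun T hT => ?_⟩⟩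
    have h1 := sum_le_hausdorffMeasure
      (region_inter_measurableSet (B.solution (R ++ [(0, t)] ++ T)) hband) H
      (fun i : ℕ => (Ico ((i : ℝ) * w) ((i + 1) * w)) ×ˢ Ioc t₀ t)
      (fun _ => ENNReal.ofReal (t - t₀)) (hmeas H) (pairwiseDisjoint_cells hw _ _) (by
        intro i hi
        obtain ⟨p, hp, hpt, hp1, hp2⟩ := (Finset.mem_filter.1 hi).2
        refine le_trans ?_ (measure_mono (hsubset _ i))
        have h2 := ofReal_le_of_reachable (v := t - t₀) (a := i * w) (b := (i + 1) * w)
          ((hB.reachable hwait hp).mono (B.solution_subset_append _ T)) ht₀ hp1 hp2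
          (by rw [hpt]) (by linarith) (by linarith)
        rwa [hpt] at h2)
    refine le_trans ?_ h1
    rw [← ENNReal.ofReal_sum_of_nonneg (fun _ _ => by linarith), Finset.sum_const, nsmul_eq_mul]
    refine ENNReal.ofReal_le_ofReal (mul_le_mul_of_nonneg_right ?_ (by linarith))
    have : (m : ℝ) ≤ 2 * H.card := by exact_mod_cast hgood
    linarith
  · set Z : List Point := U.toList.map fun i : ℕ => ((i * w + w / 2, t) : Point) with hZ
    have hmemZ : ∀ r, r ∈ Z ↔ ∃ i ∈ U, ((i * w + w / 2, t) : Point) = r := by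
      intro r; simp [hZ]
    have hinst : IsInstance (R ++ ([(0, t)] ++ Z)) := by
      rw [← List.append_assoc]
      refine ⟨?_, ?_, ?_⟩
      · refine List.nodup_append.2 ⟨hwait.nodup, ?_, ?_⟩
        · refine List.Nodup.map ?_ U.nodup_toList
          intro i j hij
          have h1 : (i : ℝ) * w + w / 2 = j * w + w / 2 := congrArg Prod.fst hij
          have h2 : (i : ℝ) * w = j * w := by linarith
          exact_mod_cast mul_right_cancel₀ hw.ne' h2
        · intro a ha b hb hab
          obtain ⟨i, -, rfl⟩ := (hmemZ b).1 hb
          rcases List.mem_append.1 ha with h | h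
          · have := hRt a h
            rw [hab] at this
            exact absurd this (not_le.2 hlt)
          · rw [List.mem_singleton] at h
            rw [h] at hab
            have h1 : (0 : ℝ) = i * w + w / 2 := congrArg Prod.fst hab
            have : (0 : ℝ) < i * w + w / 2 := by positivity
            linarith
      · intro r hr
        rcases List.mem_append.1 hr with h | h
        · exact hwait.nonneg r h
        · obtain ⟨i, -, rfl⟩ := (hmemZ r).1 h
          exact ⟨by positivity, ht₀.trans hlt.le⟩
      · refine List.pairwise_append.2 ⟨hwait.sorted, ?_, ?_⟩
        · refine List.pairwise_of_forall_mem_list ?_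
          intro a ha b hb
          obtain ⟨i, -, rfl⟩ := (hmemZ a).1 ha
          obtain ⟨j, -, rfl⟩ := (hmemZ b).1 hb
          exact le_rfl
        · intro a ha b hb
          obtain ⟨i, -, rfl⟩ := (hmemZ b).1 hb
          rcases List.mem_append.1 ha with h | h
          · exact (hRt a h).trans hlt.le
          · rw [List.mem_singleton] at h
            rw [h]
    have hlen : Z.length ≤ m := by simp [hZ]; omega
    refine ⟨[(0, t)] ++ Z, hinst, by simp; omega, Z, ?_, ?_, Or.inr ⟨hlen, fun T hT => ?_⟩⟩
    · intro r hr
      simpa using hr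
    · intro r hr
      obtain ⟨i, hi, rfl⟩ := (hmemZ r).1 hr
      have h1 := Finset.mem_range.1 (Finset.mem_filter.1 hi).1
      have h2 : (i : ℝ) + 1 ≤ m := by exact_mod_cast h1
      have h3 := mul_le_mul_of_nonneg_right h2 hw.le
      exact ⟨rfl, by positivity, by simp only; linarith⟩
    · have hre : R ++ ([(0, t)] ++ Z) ++ T = (R ++ [(0, t)]) ++ (Z ++ T) := by simp
      rw [hre] at hT ⊢
      have h1 := sum_le_hausdorffMeasure
        (region_inter_measurableSet (B.solution ((R ++ [(0, t)]) ++ (Z ++ T))) hband) U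
        (fun i : ℕ => (Ico ((i : ℝ) * w) ((i + 1) * w)) ×ˢ Ioc t₀ t)
        (fun _ => ENNReal.ofReal (w / 6)) (hmeas U) (pairwiseDisjoint_cells hw _ _) (by
          intro i hi
          have hno := (Finset.mem_filter.1 hi).2
          refine le_trans ?_ (measure_mono (hsubset _ i))
          exact ofReal_le_of_unreached (c := (i * w + w / 2, t)) (q := (0, t)) hB hT (by simp) rfl
            (List.mem_append_right _ (List.mem_append_left _ ((hmemZ _).2 ⟨i, hi, rfl⟩)))
            (a := i * w) (b := (i + 1) * w) (a' := i * w + w / 3) (b' := i * w + 2 * w / 3) ht₀ hlt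
            (by linarith) (by linarith)
            (fun p hp hpt hp' => hno ⟨p, hp, hpt, hp'.1, hp'.2⟩)
            (by simp only; linarith) (by simp only; linarith))
      refine le_trans ?_ h1
      rw [← ENNReal.ofReal_sum_of_nonneg (fun _ _ => by positivity), Finset.sum_const, nsmul_eq_mul]
      refine ENNReal.ofReal_le_ofReal (mul_le_mul_of_nonneg_right ?_ (by positivity))
      have h2 : m ≤ 2 * U.card := by omega
      have : (m : ℝ) ≤ 2 * U.card := by exact_mod_cast h2
      linarith

lemma cost_union_le [DecidableEq Seg] (F G : Finset Seg) : cost (F ∪ G) ≤ cost F + cost G := by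
  unfold cost
  rw [← Finset.sum_union_inter]
  exact le_add_of_nonneg_right (Finset.sum_nonneg fun s _ => s.length_nonneg)

/-- The adversary after `l` stages, `b` of which ended with a batch of requests. -/
lemma exists_stages {B : Strategy} (hB : IsOnlineAlgorithm B) {s k : ℕ} (hs : 1 ≤ s) :
    ∀ l ≤ k, ∃ (R : List Point) (b g : ℕ) (Z : Finset Seg), IsInstance R ∧
      ((6 * s * 2 ^ k, 0) : Point) ∈ R ∧ (∀ r ∈ R, r.2 ≤ 2 ^ l) ∧
      R.length + 2 ^ (k - l) ≤ 1 + l + 2 ^ k ∧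
      (∀ r ∈ R, r.1 ≤ 6 * s * 2 ^ k ∧ (r.2 = 0 ∨ r.1 = 0 ∨ mkSeg (r.1, 0) r ∈ Z)) ∧
      b + g = l ∧ cost Z ≤ b * 2 ^ k ∧
      ∀ T, IsInstance (R ++ T) → ENNReal.ofReal (2 ^ k * (g / 4 + b * s / 2)) ≤
        μH[1] (region (B.solution (R ++ T)) ∩ {p | p.2 ≤ 2 ^ l}) := by
  classical
  have hs' : (1 : ℝ) ≤ s := by exact_mod_cast hs
  intro l
  induction l with
  | zero =>
    intro _
    refine ⟨[(6 * s * 2 ^ k, 0)], 0, 0, ∅, ⟨by simp, by simp, by simp⟩, by simp,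
      by simp, by simp, by simp, rfl, by simp [cost], fun T _ => by simp⟩
  | succ l ih =>
    intro hl
    obtain ⟨R, b, g, Z, hR, hX, hRt, hlen, hRZ, hbg, hZ, hmass⟩ := ih (by omega)
    -- The number of cells times the height is the same in all stages, so gains and offline costs
    -- per stage do not depend on `l`.
    have hpow : (2 : ℝ) ^ (k - (l + 1)) * 2 ^ (l + 1) = 2 ^ k := by
      rw [← pow_add]; congr 1; omega
    have hl0 : (0 : ℝ) < 2 ^ l := by positivity
    have hsl : (2 : ℝ) ^ l ≤ s * 2 ^ l := le_mul_of_one_le_left hl0.le hs'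
    obtain ⟨S, hRS, hSlen, Y, hSY, hY, hcase⟩ := exists_stage hB hR (t₀ := 2 ^ l)
      (t := 2 ^ (l + 1)) (w := 6 * s * 2 ^ (l + 1)) (by positivity) (by rw [pow_succ]; linarith)
      (by positivity) (by rw [pow_succ]; linarith) hRt (2 ^ (k - (l + 1)))
    -- The cells of every stage tile the same base line, which one offline segment at height 0
    -- covers.
    have hX' : ((2 ^ (k - (l + 1)) : ℕ) : ℝ) * (6 * s * 2 ^ (l + 1)) = 6 * s * 2 ^ k := by
      push_cast; rw [← hpow]; ring
    rw [hX'] at hY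
    have hlen' : (R ++ S).length + 2 ^ (k - (l + 1)) ≤ 1 + (l + 1) + 2 ^ k := by
      have : 2 ^ (k - l) = 2 * 2 ^ (k - (l + 1)) := by
        rw [← pow_succ']; congr 1; omega
      rw [List.length_append]
      omega
    have hheight : ∀ r ∈ R ++ S, r.2 ≤ (2 : ℝ) ^ (l + 1) := by
      intro r hr
      rcases List.mem_append.1 hr with h | h
      · have := hRt r h
        rw [pow_succ]; linarith
      · rcases hSY r h with rfl | h
        · exact le_rfl
        · exact (hY r h).1.le
    set Z' := Z ∪ Y.toFinset.image fun r => mkSeg (r.1, 0) r with hZ'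
    have hRZ' : ∀ r ∈ R ++ S, r.1 ≤ 6 * s * 2 ^ k ∧
        (r.2 = 0 ∨ r.1 = 0 ∨ mkSeg (r.1, 0) r ∈ Z') := by
      intro r hr
      rcases List.mem_append.1 hr with h | h
      · obtain ⟨h1, h2⟩ := hRZ r h
        exact ⟨h1, h2.imp_right fun h => h.imp_right fun h => Finset.mem_union_left _ h⟩
      · rcases hSY r h with rfl | h
        · exact ⟨by positivity, Or.inr (Or.inl rfl)⟩
        · exact ⟨(hY r h).2.2, Or.inr (Or.inr (Finset.mem_union_right _
            (Finset.mem_image_of_mem (fun r : Point => mkSeg (r.1, 0) r)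
              (List.mem_toFinset.2 h))))⟩
    have hZcost : cost Z' ≤ cost Z + Y.length * 2 ^ (l + 1) := by
      refine (cost_union_le _ _).trans (add_le_add_right ?_ _)
      have h1 : ∀ σ ∈ Y.toFinset.image fun r => mkSeg (r.1, 0) r, σ.length ≤ 2 ^ (l + 1) := by
        intro σ hσ
        obtain ⟨r, hr, rfl⟩ := Finset.mem_image.1 hσ
        obtain ⟨h2, h3, -⟩ := hY r (List.mem_toFinset.1 hr)
        have h4 := (mkSeg_vertical (x := r.1) (a := 0) (b := r.2) h3 le_rfl
          (by rw [h2]; positivity)).2.2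
        rw [Prod.mk.eta] at h4
        rw [h4, h2, sub_zero]
      refine (Finset.sum_le_card_nsmul _ _ _ h1).trans ?_
      rw [nsmul_eq_mul]
      refine mul_le_mul_of_nonneg_right ?_ (by positivity)
      exact_mod_cast Finset.card_image_le.trans (List.toFinset_card_le Y)
    -- The strip of the new stage is disjoint from the earlier ones. Both estimates hold for every
    -- continuation, hence for one common solution.
    have hcombine : ∀ (T : List Point) (v v' : ℝ), 0 ≤ v → 0 ≤ v' →
        IsInstance (R ++ (S ++ T)) → ENNReal.ofReal v ≤
          μH[1] (region (B.solution (R ++ S ++ T)) ∩ {p | p.2 ≤ 2 ^ l}) →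
        ENNReal.ofReal v' ≤ μH[1] (region (B.solution (R ++ S ++ T)) ∩
          {p | 2 ^ l < p.2 ∧ p.2 ≤ 2 ^ (l + 1)}) →
        ENNReal.ofReal (v + v') ≤
          μH[1] (region (B.solution (R ++ S ++ T)) ∩ {p | p.2 ≤ 2 ^ (l + 1)}) := by
      intro T v v' hv hv' _ h1 h2
      rw [ENNReal.ofReal_add hv hv']
      refine (add_le_add h1 h2).trans ?_
      rw [← measure_union]
      · refine measure_mono (union_subset ?_ ?_)
        · rintro p ⟨hp, hp'⟩
          refine ⟨hp, show p.2 ≤ 2 ^ (l + 1) from le_trans hp' ?_⟩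
          rw [pow_succ]; linarith
        · rintro p ⟨hp, hp'⟩
          exact ⟨hp, hp'.2⟩
      · refine Set.disjoint_left.2 ?_
        rintro p ⟨_, hp⟩ ⟨_, hp', -⟩
        exact absurd hp (not_le.2 hp')
      · exact region_inter_measurableSet _
          ((measurableSet_lt measurable_const measurable_snd).inter
            (measurableSet_le measurable_snd measurable_const))
    rcases hcase with ⟨rfl, hgood⟩ | ⟨hYlen, hbad⟩
    · refine ⟨R ++ S, b, g + 1, Z', hRS, List.mem_append_left _ hX, hheight, hlen', hRZ', by omega,
        ?_, fun T hT => ?_⟩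
      · refine hZcost.trans ?_
        simpa using hZ
      · have hT' := hT
        rw [List.append_assoc] at hT'
        have h1 := hmass (S ++ T) hT'
        rw [← List.append_assoc] at h1
        have h2 := hcombine T _ _ (by positivity)
          (mul_nonneg (by positivity) (sub_nonneg.2 (by rw [pow_succ]; linarith))) hT' h1 (hgood T hT)
        refine le_trans (ENNReal.ofReal_le_ofReal (le_of_eq ?_)) h2
        have h3 : ((2 ^ (k - (l + 1)) : ℕ) : ℝ) / 2 * (2 ^ (l + 1) - 2 ^ l) = 2 ^ k / 4 := by
          push_cast; rw [← hpow]; ring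
        rw [h3]; push_cast; ring
    · refine ⟨R ++ S, b + 1, g, Z', hRS, List.mem_append_left _ hX, hheight, hlen', hRZ', by omega,
        ?_, fun T hT => ?_⟩
      · have h1 : (Y.length : ℝ) ≤ 2 ^ (k - (l + 1)) := by exact_mod_cast hYlen
        have h2 := mul_le_mul_of_nonneg_right h1 (show (0 : ℝ) ≤ 2 ^ (l + 1) by positivity)
        rw [hpow] at h2
        push_cast
        linarith
      · have hT' := hT
        rw [List.append_assoc] at hT'
        have h1 := hmass (S ++ T) hT'
        rw [← List.append_assoc] at h1
        have h2 := hcombine T _ _ (by positivity) (by positivity) hT' h1 (hbad T hT)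
        refine le_trans (ENNReal.ofReal_le_ofReal (le_of_eq ?_)) h2
        have h3 : ((2 ^ (k - (l + 1)) : ℕ) : ℝ) / 2 * (6 * s * 2 ^ (l + 1) / 6) =
            2 ^ k * s / 2 := by
          push_cast; rw [← hpow]; ring
        rw [h3]; push_cast; ring

/-- Padding to exactly `N` terminals: with a small total height, waiting requests in column 0 cost
almost nothing offline. -/
lemma isInstance_append_waiting {R : List Point} (hR : IsInstance R) {t : ℝ} (ht : 0 ≤ t)
    (hRt : ∀ r ∈ R, r.2 ≤ t) {e : ℝ} (he : 0 < e) (n : ℕ) :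
    IsInstance (R ++ (List.range n).map fun j : ℕ => ((0, t + (j + 1) * e) : Point)) := by
  refine ⟨?_, ?_, ?_⟩
  · refine List.nodup_append.2 ⟨hR.nodup, List.nodup_range.map ?_, ?_⟩
    · intro i j hij
      have h1 : t + ((i : ℝ) + 1) * e = t + ((j : ℝ) + 1) * e := congrArg Prod.snd hij
      have h2 := mul_right_cancel₀ he.ne' (add_left_cancel h1)
      exact_mod_cast add_right_cancel h2
    · intro a ha b hb hab
      obtain ⟨j, -, rfl⟩ := List.mem_map.1 hb
      have h1 := hRt a ha
      rw [hab] at h1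
      have : 0 < ((j : ℝ) + 1) * e := by positivity
      simp only at h1
      linarith
  · intro r hr
    rcases List.mem_append.1 hr with h | h
    · exact hR.nonneg r h
    · obtain ⟨j, -, rfl⟩ := List.mem_map.1 h
      exact ⟨le_rfl, by positivity⟩
  · refine List.pairwise_append.2 ⟨hR.sorted, ?_, ?_⟩
    · rw [List.pairwise_map]
      refine List.pairwise_lt_range.imp fun {i j} hij => ?_
      have h1 : (i : ℝ) ≤ j := by exact_mod_cast hij.le
      simp only
      gcongr
    · intro a ha b hb
      obtain ⟨j, -, rfl⟩ := List.mem_map.1 hb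
      refine (hRt a ha).trans (le_add_of_nonneg_right ?_)
      positivity

lemma IsOnlineAlgorithm.isFeasible {B : Strategy} (hB : IsOnlineAlgorithm B) {R : List Point}
    (hR : IsInstance R) : IsFeasible (B.solution R) R := by
  rcases List.eq_nil_or_concat R with rfl | ⟨R', r, rfl⟩
  · simp [IsFeasible]
  · rw [List.concat_eq_append] at hR ⊢
    exact hB.serves _ _ hR

lemma exists_hard_instance {B : Strategy} (hB : IsOnlineAlgorithm B) {s N : ℕ} (hs : 1 ≤ s)
    (hN : 2 ^ (s ^ 2 + 1) ≤ N) : ∃ R : List Point, IsInstance R ∧ R.length = N ∧ 0 < opt R ∧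
      (s : ℝ) / 32 * opt R ≤ cost (B.solution R) := by
  classical
  have hs' : (1 : ℝ) ≤ s := by exact_mod_cast hs
  obtain ⟨R, b, g, Z, hR, hX, hRt, hlen, hRZ, hbg, hZ, hmass⟩ :=
    exists_stages hB (k := s ^ 2) hs (s ^ 2) le_rfl
  set k := s ^ 2 with hk
  have hlenN : R.length ≤ N := by
    have : k < 2 ^ k := Nat.lt_two_pow_self
    rw [pow_succ] at hN
    simp only [Nat.sub_self, pow_zero] at hlen
    omega
  have hN0 : 0 < N := lt_of_lt_of_le (by positivity) hN
  have hN0' : (0 : ℝ) < N := by exact_mod_cast hN0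
  set T : List Point :=
    (List.range (N - R.length)).map fun j : ℕ => ((0, 2 ^ k + (j + 1) * (1 / N)) : Point) with hT
  have hRT : IsInstance (R ++ T) :=
    isInstance_append_waiting hR (by positivity) hRt (by positivity) _
  have hlenRT : (R ++ T).length = N := by simp [hT]; omega
  have hTt : ∀ r ∈ T, r.1 = 0 ∧ r.2 ≤ 2 ^ k + 1 := by
    intro r hr
    obtain ⟨j, hj, rfl⟩ := List.mem_map.1 hr
    refine ⟨rfl, ?_⟩
    have h1 : j + 1 ≤ N := by have := List.mem_range.1 hj; omega
    have h2 : (j : ℝ) + 1 ≤ N := by exact_mod_cast h1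
    have h3 : ((j : ℝ) + 1) * (1 / N) ≤ 1 := by
      rw [mul_one_div]; exact (div_le_one hN0').2 h2
    simp only
    linarith
  refine ⟨R ++ T, hRT, hlenRT, ?_, ?_⟩
  · have h1 := fst_le_opt hRT.nonneg (List.mem_append_left _ hX)
    refine lt_of_lt_of_le ?_ h1
    simp only
    positivity
  have hP : (1 : ℝ) ≤ 2 ^ k := one_le_pow₀ one_le_two
  -- The base line, the column of the waiting requests, and the vertical lines to the requested
  -- centres; the extra 1 leaves room for the padding.
  set F := Z ∪ {mkSeg (0, 0) (6 * s * 2 ^ k, 0), mkSeg (0, 0) (0, 2 ^ k + 1)} with hF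
  have hhor : mkSeg (0, 0) (6 * s * 2 ^ k, 0) ∈ F := by simp [hF]
  have hver : mkSeg (0, 0) (0, 2 ^ k + 1) ∈ F := by simp [hF]
  have hfeas : IsFeasible F (R ++ T) := by
    have hbase : ∀ x : ℝ, 0 ≤ x → x ≤ 6 * s * 2 ^ k → Reachable F (x, 0) := by
      intro x h1 h2
      exact .single (step_horizontal le_rfl le_rfl (by positivity)
        (by rw [uIcc_of_le (by positivity)]; exact ⟨h1, h2⟩) hhor)
    have hside : ∀ y : ℝ, 0 ≤ y → y ≤ 2 ^ k + 1 → Reachable F (0, y) := fun y h1 h2 =>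
      .single (step_vertical le_rfl le_rfl h1 h2 hver)
    intro r hr
    obtain ⟨hr1, hr2⟩ := hRT.nonneg r hr
    rcases List.mem_append.1 hr with h | h
    · obtain ⟨h1, h2 | h2 | h2⟩ := hRZ r h
      · have := hbase r.1 hr1 h1
        rwa [← h2, Prod.mk.eta] at this
      · have := hside r.2 hr2 (by linarith [hRt r h])
        rwa [← h2, Prod.mk.eta] at this
      · have h3 := step_vertical (F := F) (x := r.1) hr1 le_rfl hr2 le_rfl
          (Finset.mem_union_left _ (by rwa [Prod.mk.eta]))
        exact (hbase r.1 hr1 h1).tail h3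
    · obtain ⟨h1, h2⟩ := hTt r h
      have := hside r.2 hr2 h2
      rwa [← h1, Prod.mk.eta] at this
  have hcostF : cost F ≤ b * 2 ^ k + (6 * s * 2 ^ k + (2 ^ k + 1)) := by
    refine (cost_union_le _ _).trans (add_le_add hZ ?_)
    have h1 : cost {mkSeg (0, 0) (6 * s * 2 ^ k, 0), mkSeg (0, 0) (0, 2 ^ k + 1)} ≤
        (mkSeg (0, 0) (6 * s * 2 ^ k, 0)).length + (mkSeg (0, 0) (0, 2 ^ k + 1)).length := by
      rw [Finset.insert_eq]
      refine (cost_union_le _ _).trans ?_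
      simp [cost]
    rw [(mkSeg_horizontal le_rfl le_rfl (by positivity)).2.2,
      (mkSeg_vertical le_rfl le_rfl (by positivity)).2.2, sub_zero, sub_zero,
      abs_of_nonneg (by positivity)] at h1
    exact h1
  have hopt := opt_le_cost hfeas
  have hlow : 2 ^ k * (g / 4 + b * s / 2) ≤ cost (B.solution (R ++ T)) := by
    have h1 := (hmass T hRT).trans ((measure_mono inter_subset_left).trans
      (hausdorffMeasure_region_le _))
    rwa [ENNReal.ofReal_le_ofReal_iff (cost_nonneg _)] at h1
  refine le_trans ?_ hlow
  have hbg' : (g : ℝ) = s ^ 2 - b := by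
    have : (b : ℝ) + g = s ^ 2 := by exact_mod_cast hbg
    linarith
  have hb0 : (0 : ℝ) ≤ b := by positivity
  have h2 : opt (R ++ T) ≤ 2 ^ k * (8 * s + b) := by
    have h3 : (2 : ℝ) ^ k ≤ s * 2 ^ k := le_mul_of_one_le_left (by positivity) hs'
    calc opt (R ++ T) ≤ b * 2 ^ k + (6 * s * 2 ^ k + (2 ^ k + 1)) := hopt.trans hcostF
      _ ≤ b * 2 ^ k + (6 * s * 2 ^ k + (s * 2 ^ k + s * 2 ^ k)) := by linarith
      _ = _ := by ring
  calc (s : ℝ) / 32 * opt (R ++ T) ≤ s / 32 * (2 ^ k * (8 * s + b)) := by gcongr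
    _ = 2 ^ k * (s / 32 * (8 * s + b)) := by ring
    _ ≤ 2 ^ k * (g / 4 + b * s / 2) := by
      refine mul_le_mul_of_nonneg_left ?_ (by positivity)
      rw [hbg']
      -- The terms s²/4 on both sides agree; what remains is b(s/32 + 1/4) ≤ bs/2, where s ≥ 1
      -- enters.
      nlinarith [mul_nonneg hb0 (sub_nonneg.2 hs')]

lemma exists_easy_instance {B : Strategy} (hB : IsOnlineAlgorithm B) {N : ℕ} (hN : 1 ≤ N) :
    ∃ R : List Point, IsInstance R ∧ R.length = N ∧ 0 < opt R ∧ opt R ≤ cost (B.solution R) := by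
  have h := isInstance_append_waiting (R := []) ⟨List.nodup_nil, by simp, List.Pairwise.nil⟩
    (le_refl (0 : ℝ)) (by simp) one_pos N
  refine ⟨_, h, by simp, ?_, opt_le_cost (hB.isFeasible h)⟩
  refine lt_of_lt_of_le one_pos (snd_le_opt h.nonneg (r := (0, 1)) ?_)
  simp only [List.nil_append, List.mem_map, List.mem_range]
  exact ⟨0, hN, by simp⟩

theorem exists_lower_bound : ∃ c : ℝ, 0 < c ∧ ∀ B : Strategy, IsOnlineAlgorithm B → ∀ N : ℕ,
    2 ≤ N → ∃ R : List Point, IsInstance R ∧ R.length = N ∧ 0 < opt R ∧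
      c * Real.sqrt (Real.log (N : ℝ)) * opt R ≤ cost (B.solution R) := by
  refine ⟨1 / 96, by norm_num, fun B hB N hN => ?_⟩
  have hlog : Real.log N ≤ Nat.log 2 N + 1 := by
    have h1 : N < 2 ^ (Nat.log 2 N + 1) := Nat.lt_pow_succ_log_self one_lt_two N
    have h2 : (N : ℝ) ≤ 2 ^ (Nat.log 2 N + 1) := by exact_mod_cast h1.le
    have h3 := Real.log_le_log (by positivity) h2
    rw [Real.log_pow] at h3
    push_cast at h3
    have h4 := Real.log_two_lt_d9
    have h5 : (0 : ℝ) ≤ Nat.log 2 N + 1 := by positivity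
    nlinarith
  have hN1 : 1 ≤ Nat.log 2 N := Nat.log_pos one_lt_two hN
  -- The largest `s` with 2^(s² + 1) ≤ N, so that the adversary's at most s² + 2^(s²) requests fit
  -- into `N`.
  set s := Nat.sqrt (Nat.log 2 N - 1) with hs
  have hs1 : s ^ 2 + 1 ≤ Nat.log 2 N := by
    have := Nat.sqrt_le' (Nat.log 2 N - 1)
    rw [← hs] at this
    omega
  have hs2 : Nat.log 2 N < (s + 1) ^ 2 + 1 := by
    have := Nat.lt_succ_sqrt' (Nat.log 2 N - 1)
    simp only [Nat.succ_eq_add_one, ← hs] at this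
    omega
  have hs3 : (Nat.log 2 N : ℝ) ≤ (s + 1) ^ 2 := by
    have : Nat.log 2 N ≤ (s + 1) ^ 2 := by omega
    exact_mod_cast this
  -- For `s = 0` the number `N` is 2 or 3, and the trivial ratio 1 is enough.
  rcases Nat.eq_zero_or_pos s with h0 | hpos
  · obtain ⟨R, h1, h2, h3, h4⟩ := exists_easy_instance hB (N := N) (by omega)
    refine ⟨R, h1, h2, h3, le_trans (mul_le_of_le_one_left h3.le ?_) h4⟩
    rw [h0] at hs3
    have : Real.sqrt (Real.log N) ≤ 2 := by
      rw [Real.sqrt_le_left (by norm_num)]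
      have h5 : (Nat.log 2 N : ℝ) ≤ 1 := by simpa using hs3
      linarith
    linarith
  · obtain ⟨R, h1, h2, h3, h4⟩ := exists_hard_instance hB (N := N) hpos
      ((Nat.pow_le_pow_right two_pos hs1).trans (Nat.pow_log_le_self 2 (by omega)))
    refine ⟨R, h1, h2, h3, le_trans (mul_le_mul_of_nonneg_right ?_ h3.le) h4⟩
    have hs' : (1 : ℝ) ≤ s := by exact_mod_cast hpos
    have : Real.sqrt (Real.log N) ≤ 3 * s := by
      rw [Real.sqrt_le_left (by positivity)]
      nlinarith
    linarith

/-! ### Upper bound: packing and charging against an arbitrary solution. -/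

/-- The origin lies outside the box because `d ≤ max r.1 r.2`, so a path to `r` must run from the
boundary of the box to `r`. -/
lemma ofReal_half_le {F : Finset Seg} {r : Point} (hr : Reachable F r) {d : ℝ}
    (hd : d ≤ max r.1 r.2) : ENNReal.ofReal (d / 2) ≤
      μH[1] (region F ∩ (Ioo (r.1 - d / 2) (r.1 + d / 2) ×ˢ Ioc (r.2 - d / 2) r.2)) := by
  obtain ⟨K, -, hK, h0, hrK, hsub, hKw⟩ := exists_path hr
  by_contra hlt
  set Q := region F ∩ (Ioo (r.1 - d / 2) (r.1 + d / 2) ×ˢ Ioc (r.2 - d / 2) r.2) with hQ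
  have hy : ∃ t ∈ Ioo (r.2 - d / 2) r.2, ∀ w ∈ Q, w.2 ≠ t := by
    by_contra! hcon
    have := ofReal_le_hausdorffMeasure_of_snd hcon
    rw [sub_sub_cancel] at this
    exact hlt this
  have hx₁ : ∃ t ∈ Ioo (r.1 - d / 2) r.1, ∀ w ∈ Q, w.1 ≠ t := by
    by_contra! hcon
    have := ofReal_le_hausdorffMeasure_of_fst hcon
    rw [sub_sub_cancel] at this
    exact hlt this
  have hx₂ : ∃ t ∈ Ioo r.1 (r.1 + d / 2), ∀ w ∈ Q, w.1 ≠ t := by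
    by_contra! hcon
    have := ofReal_le_hausdorffMeasure_of_fst hcon
    rw [add_sub_cancel_left] at this
    exact hlt this
  obtain ⟨t, ht, hy⟩ := hy
  obtain ⟨x₁, hx₁, hw₁⟩ := hx₁
  obtain ⟨x₂, hx₂, hw₂⟩ := hx₂
  have hbox : ∀ w ∈ K, t ≤ w.2 → x₁ ≤ w.1 → w.1 ≤ x₂ → w ≠ r → w ∈ Q := by
    intro w hw h1 h2 h3 h4
    rcases hsub hw with h5 | h5
    · exact ⟨h5, ⟨hx₁.1.trans_le h2, h3.trans_lt hx₂.2⟩, ht.1.trans_le h1, (hKw w hw).2.1⟩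
    · exact absurd h5 h4
  obtain ⟨w, hw, h1, h2, h3⟩ := exists_crossing_below hK (x₁ := x₁) (x₂ := x₂) (h := t) hrK h0
    hx₁.2 hx₂.1 ht.2 (by
      rcases le_max_iff.1 hd with h | h
      · exact Or.inl (by simp only; linarith [hx₁.1, ht.1, ht.2])
      · exact Or.inr (Or.inr (by simp only; linarith [ht.1, ht.2]))) (by
      intro w hw hhw
      have hx : x₁ ≤ x₂ := by linarith [hx₁.2, hx₂.1]
      constructor
      · rintro h5
        refine hw₁ w (hbox w hw hhw h5.ge (h5.trans_le hx) ?_) h5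
        rintro rfl
        exact absurd h5 hx₁.2.ne'
      · rintro h5
        refine hw₂ w (hbox w hw hhw (hx.trans_eq h5.symm) h5.le ?_) h5
        rintro rfl
        exact absurd h5 hx₂.1.ne)
  refine hy w (hbox w hw h1.ge h2.le h3.le ?_) h1
  rintro rfl
  exact absurd h1 ht.2.ne'

/-- The distances of the requests from the earlier ones (each of them being widened by its own
distance) are at most a constant times the cost of any solution. -/
lemma sum_dist_le_cost {F : Finset Seg} {E : Finset ℕ} {x y ρ : ℕ → ℝ}
    (hρ : ∀ i ∈ E, 0 ≤ ρ i) (hreach : ∀ i ∈ E, Reachable F (x i, y i))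
    (h0 : ∀ i ∈ E, ρ i ≤ max (x i) (y i))
    (hdist : ∀ i ∈ E, ∀ j ∈ E, j < i → ρ i ≤ max (|x i - x j| - ρ j) (y i - y j)) :
    ∑ i ∈ E, ρ i ≤ 2 * cost F := by
  -- Either the horizontal distance is at least `ρ i + ρ j`, or box `i` lies above `y j`.
  -- Subtracting `ρ j` in the distance is harmless because the half-widths add up to only `(ρ i + ρ
  -- j) / 2`.
  have hdisj : ∀ i ∈ E, ∀ j ∈ E, j < i → ∀ p : Point,
      p ∈ Ioo (x i - ρ i / 2) (x i + ρ i / 2) ×ˢ Ioc (y i - ρ i / 2) (y i) →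
      p ∉ Ioo (x j - ρ j / 2) (x j + ρ j / 2) ×ˢ Ioc (y j - ρ j / 2) (y j) := by
    rintro i hi j hj hij p ⟨⟨h1, h2⟩, h3, h4⟩ ⟨⟨h5, h6⟩, h7, h8⟩
    rcases le_max_iff.1 (hdist i hi j hj hij) with h | h
    · have : |x i - x j| < ρ i / 2 + ρ j / 2 := abs_lt.2 ⟨by linarith, by linarith⟩
      linarith [hρ i hi, hρ j hj]
    · linarith [hρ i hi]
  have h1 := sum_le_hausdorffMeasure (isCompact_region F).measurableSet E
    (fun i => Ioo (x i - ρ i / 2) (x i + ρ i / 2) ×ˢ Ioc (y i - ρ i / 2) (y i))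
    (fun i => ENNReal.ofReal (ρ i / 2)) (fun i _ => measurableSet_Ioo.prod measurableSet_Ioc)
    (by
      intro i hi j hj hij
      refine Set.disjoint_left.2 fun p hp hp' => ?_
      rcases lt_or_gt_of_ne hij with h | h
      · exact hdisj j hj i hi h p hp' hp
      · exact hdisj i hi j hj h p hp hp')
    (fun i hi => ofReal_half_le (hreach i hi) (h0 i hi))
  rw [← ENNReal.ofReal_sum_of_nonneg fun i hi => by linarith [hρ i hi]] at h1
  have h2 := h1.trans (hausdorffMeasure_region_le F)
  rw [ENNReal.ofReal_le_ofReal_iff (cost_nonneg F), ← Finset.sum_div] at h2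
  linarith

/-- A copy of the file that is kept from the height `y₀` to the height `y₁` for the sake of the
position `z` at distance `a` from an earlier request: there is a lot of length nearby, or the
solution `F` passes by, or a part of `F` dies out. -/
lemma length_near_copy {F : Finset Seg} {U : Set Point} {xj yj ρ z a δ y₀ y₁ : ℝ}
    (hU : region F ⊆ U) (hH : segment ℝ ((xj - ρ, yj) : Point) (xj + ρ, yj) ⊆ U)
    (hreach : Reachable F (xj, yj)) (hδ : 1 ≤ δ) (ha : 0 < a) (hya : y₁ - a ≤ yj) (hyj : yj ≤ y₀)
    (hy : y₀ ≤ y₁) (hz : |z - xj| ≤ ρ + a) (hz0 : 4 * δ * a < z) :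
    ENNReal.ofReal (δ * a) ≤
      μH[1] (U ∩ (Icc (z - 4 * δ * a) (z + 4 * δ * a) ×ˢ Icc (y₁ - 5 * a) y₁)) ∨
    ENNReal.ofReal (y₁ - y₀) ≤
      μH[1] (U ∩ (Icc (z - 4 * δ * a) (z + 4 * δ * a) ×ˢ Ioc y₀ y₁)) ∨
    ∃ W : Set Point, MeasurableSet W ∧ ENNReal.ofReal a ≤ μH[1] (U ∩ W) ∧
      ∀ p ∈ W, p.1 ∈ Icc (z - 4 * δ * a) (z + 4 * δ * a) ∧ p.2 ∈ Icc (y₁ - 4 * a) (y₁ - 3 * a) ∧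
        Relation.ReflTransGen (Step F) p (xj, yj) ∧
        ∀ r : Point, y₁ < r.2 → ¬ Relation.ReflTransGen (Step F) p r := by
  have hδa : a ≤ δ * a := le_mul_of_one_le_left ha.le hδ
  obtain ⟨hz1, hz2⟩ := abs_le.1 hz
  -- A wide request brings `δ * a` of its own segment into the window around `z`. Otherwise `|z -
  -- xj| < 2δa`, and the path of `F` to the request is examined.
  rcases le_or_gt (δ * a) ρ with hρ | hρ
  · left
    have key : ∃ t, xj - ρ ≤ t ∧ t + δ * a ≤ xj + ρ ∧ z - 4 * δ * a ≤ t ∧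
        t + δ * a ≤ z + 4 * δ * a := by
      rcases le_total z xj with h | h
      · rcases le_total (xj - ρ) z with h' | h'
        · exact ⟨z, by linarith, by linarith, by linarith, by linarith⟩
        · exact ⟨xj - ρ, by linarith, by linarith, by linarith, by linarith⟩
      · rcases le_total z (xj + ρ) with h' | h'
        · exact ⟨z - δ * a, by linarith, by linarith, by linarith, by linarith⟩
        · exact ⟨xj + ρ - δ * a, by linarith, by linarith, by linarith, by linarith⟩
    obtain ⟨t, h1, h2, h3, h4⟩ := key
    have h5 := ofReal_le_hausdorffMeasure_of_fst (a := t) (b := t + δ * a)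
      (A := U ∩ (Icc (z - 4 * δ * a) (z + 4 * δ * a) ×ˢ Icc (y₁ - 5 * a) y₁)) (by
        intro u hu
        refine ⟨(u, yj), ⟨hH (mem_segment_horizontal.2 ⟨?_, rfl⟩), ?_⟩, rfl⟩
        · rw [uIcc_of_le (by linarith)]
          exact ⟨by linarith [hu.1], by linarith [hu.2]⟩
        · exact ⟨⟨by simp only; linarith [hu.1], by simp only; linarith [hu.2]⟩,
            by simp only; linarith, by simp only; linarith⟩)
    rwa [add_sub_cancel_left] at h5
  by_contra! hcon
  obtain ⟨hwide, halive, hdead⟩ := hcon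
  -- Too little length leaves a free column on each side, beyond `xj` but inside the window.
  have hx₁ : ∃ t ∈ Ioo (z - 3 * δ * a) (z - 2 * δ * a), ∀ w ∈ U ∩
      (Icc (z - 4 * δ * a) (z + 4 * δ * a) ×ˢ Icc (y₁ - 5 * a) y₁), w.1 ≠ t := by
    by_contra! hcon
    refine hwide.not_ge (le_trans (ENNReal.ofReal_le_ofReal ?_)
      (ofReal_le_hausdorffMeasure_of_fst hcon))
    linarith
  have hx₂ : ∃ t ∈ Ioo (z + 2 * δ * a) (z + 3 * δ * a), ∀ w ∈ U ∩
      (Icc (z - 4 * δ * a) (z + 4 * δ * a) ×ˢ Icc (y₁ - 5 * a) y₁), w.1 ≠ t := by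
    by_contra! hcon
    refine hwide.not_ge (le_trans (ENNReal.ofReal_le_ofReal ?_)
      (ofReal_le_hausdorffMeasure_of_fst hcon))
    linarith
  have hty : ∃ t ∈ Ioo y₀ y₁, ∀ w ∈ U ∩
      (Icc (z - 4 * δ * a) (z + 4 * δ * a) ×ˢ Ioc y₀ y₁), w.2 ≠ t := by
    by_contra! hcon
    exact halive.not_ge (ofReal_le_hausdorffMeasure_of_snd hcon)
  obtain ⟨x₁, hx₁, hw₁⟩ := hx₁
  obtain ⟨x₂, hx₂, hw₂⟩ := hx₂
  obtain ⟨t, ht, hwt⟩ := hty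
  have hcolumn : ∀ w ∈ region F, y₁ - 5 * a ≤ w.2 → w.2 ≤ y₁ → w.1 ≠ x₁ ∧ w.1 ≠ x₂ := by
    intro w hw h1 h2
    constructor
    · intro h3
      exact hw₁ w ⟨hU hw, ⟨by linarith [hx₁.1], by linarith [hx₁.2]⟩, h1, h2⟩ h3
    · intro h3
      exact hw₂ w ⟨hU hw, ⟨by linarith [hx₂.1], by linarith [hx₂.2]⟩, h1, h2⟩ h3
  obtain ⟨K, hKc, hK, h0, hjK, hsub, hKw⟩ := exists_path hreach
  have hKcol : ∀ w ∈ K, y₁ - 5 * a ≤ w.2 → w.1 ≠ x₁ ∧ w.1 ≠ x₂ := by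
    intro w hw h1
    rcases hsub hw with h2 | h2
    · exact hcolumn w h2 h1 (by linarith [(hKw w hw).2.1])
    · rw [mem_singleton_iff] at h2
      rw [h2]
      exact ⟨by simp only; linarith [hx₁.2], by simp only; linarith [hx₂.1]⟩
  -- By `hz0` the origin lies to the left of `x₁`, so the path to the request must come from below
  -- and meets every height of this band between the free columns.
  obtain ⟨p, hpW, hp⟩ := hdead (K ∩ (Icc x₁ x₂ ×ˢ Icc (y₁ - 4 * a) (y₁ - 3 * a)))
    (hKc.measurableSet.inter (measurableSet_Icc.prod measurableSet_Icc)) (by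
      have h1 := ofReal_le_hausdorffMeasure_of_snd (a := y₁ - 4 * a) (b := y₁ - 3 * a)
        (A := U ∩ (K ∩ (Icc x₁ x₂ ×ˢ Icc (y₁ - 4 * a) (y₁ - 3 * a)))) (by
          intro h hh
          obtain ⟨w, hw, h1, h2, h3⟩ := exists_crossing_below hK (x₁ := x₁) (x₂ := x₂) (h := h)
            hjK h0 (by simp only; linarith [hx₁.2]) (by simp only; linarith [hx₂.1])
            (by simp only; linarith [hh.2]) (Or.inl (by simp only; linarith [hx₁.1]))
            fun w hw hhw => hKcol w hw (by linarith [hh.1])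
          refine ⟨w, ⟨?_, hw, ⟨h2.le, h3.le⟩, by linarith [hh.1], by linarith [hh.2]⟩, h1⟩
          rcases hsub hw with h4 | h4
          · exact hU h4
          · rw [mem_singleton_iff] at h4
            rw [h4] at h1
            simp only at h1
            linarith [hh.2])
      refine le_trans (ENNReal.ofReal_le_ofReal ?_) h1
      linarith)
  obtain ⟨hpK, ⟨hp1, hp2⟩, hp3, hp4⟩ := hpW
  obtain ⟨r, hr, hpr⟩ := hp ⟨by linarith [hx₁.1], by linarith [hx₂.2]⟩ ⟨hp3, hp4⟩
    (hKw p hpK).2.2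
  obtain ⟨K', -, hK', hpK', hrK', hsub', hKw'⟩ := exists_path hpr
  obtain ⟨hp5, hp6⟩ := hKcol p hpK (by linarith)
  have hreg : ∀ w ∈ K', w.2 ≤ t → w ∈ region F := by
    intro w hw hwt
    rcases hsub' hw with h | h
    · exact h
    · rw [mem_singleton_iff] at h
      rw [h] at hwt
      linarith [ht.2]
  -- A path from `p` to a point above `y₁` is caught between the free columns and has to cross the
  -- free height `t`.
  obtain ⟨w, hw, h1, h2, h3⟩ := exists_crossing_above hK' (x₁ := x₁) (x₂ := x₂) (h := t) hpK' hrK'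
    (lt_of_le_of_ne hp1 hp5.symm) (lt_of_le_of_ne hp2 hp6) (by linarith [ht.1])
    (Or.inr (Or.inr (ht.2.trans hr)))
    fun w hw hwt => hcolumn w (hreg w hw hwt) (by linarith [(hKw' w hw).1])
      (hwt.trans ht.2.le)
  exact hwt w ⟨hU (hreg w hw h1.le), ⟨by linarith [hx₁.1], by linarith [hx₂.2]⟩,
    by rw [h1]; exact ht.1, by rw [h1]; exact ht.2.le⟩ h1

/-- Charging weighted lengths `v e` in the sets `W e` to the points of a set of finite length. -/
lemma sum_mul_le_of_charge {ι : Type*} {A : Set Point} {M C : ℝ}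
    (hM : μH[1] A ≤ ENNReal.ofReal M) (hM0 : 0 ≤ M) (hC0 : 0 ≤ C) (E : Finset ι)
    (W : ι → Set Point) (w v : ι → ℝ) (hW : ∀ e ∈ E, MeasurableSet (W e))
    (hw : ∀ e ∈ E, 0 ≤ w e) (hv : ∀ e ∈ E, 0 ≤ v e)
    (hmass : ∀ e ∈ E, ENNReal.ofReal (v e) ≤ μH[1] (A ∩ W e))
    (hC : ∀ p ∈ A, ∑ e ∈ E, (W e).indicator (fun _ => w e) p ≤ C) :
    ∑ e ∈ E, w e * v e ≤ C * M := by
  rw [← ENNReal.ofReal_le_ofReal_iff (by positivity),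
    ENNReal.ofReal_sum_of_nonneg fun e he => mul_nonneg (hw e he) (hv e he)]
  calc ∑ e ∈ E, ENNReal.ofReal (w e * v e)
      ≤ ∑ e ∈ E, ENNReal.ofReal (w e) * (μH[1]).restrict A (W e) := by
        refine Finset.sum_le_sum fun e he => ?_
        rw [ENNReal.ofReal_mul (hw e he), Measure.restrict_apply (hW e he), inter_comm]
        exact mul_le_mul_right (hmass e he) _
    _ = ∑ e ∈ E, ∫⁻ p in A, (W e).indicator (fun _ => ENNReal.ofReal (w e)) p ∂μH[1] :=
        Finset.sum_congr rfl fun e he => (lintegral_indicator_const (hW e he) _).symm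
    _ = ∫⁻ p in A, ∑ e ∈ E, (W e).indicator (fun _ => ENNReal.ofReal (w e)) p ∂μH[1] :=
        (lintegral_finsetSum' _ fun e he =>
          (measurable_const.indicator (hW e he)).aemeasurable).symm
    _ ≤ ∫⁻ _ in A, ENNReal.ofReal C ∂μH[1] := by
        refine setLIntegral_mono measurable_const fun p hp => ?_
        have h1 : ∀ e ∈ E, (W e).indicator (fun _ => ENNReal.ofReal (w e)) p =
            ENNReal.ofReal ((W e).indicator (fun _ => w e) p) := by
          intro e _
          by_cases hp : p ∈ W e <;> simp [hp]
        rw [Finset.sum_congr rfl h1, ← ENNReal.ofReal_sum_of_nonneg fun e he =>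
          indicator_nonneg (fun _ _ => hw e he) p]
        exact ENNReal.ofReal_le_ofReal (hC p hp)
    _ = ENNReal.ofReal C * μH[1] A := by rw [setLIntegral_const]
    _ ≤ ENNReal.ofReal C * ENNReal.ofReal M := mul_le_mul_right hM _
    _ = _ := (ENNReal.ofReal_mul hC0).symm

/-- An interval contains its own copy and no other. Two intervals through `p` whose copies lie on
the same side of `p` would share the copy nearer to `p`, so each side contributes at most one. -/
lemma card_filter_irredundant_le {S : Finset ℝ} {z r : ℝ → ℝ} (h1 : ∀ c ∈ S, |c - z c| ≤ r c)
    (h2 : ∀ c ∈ S, ∀ c' ∈ S, |c' - z c| ≤ r c → c' = c) (p : ℝ) :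
    (S.filter fun c => |p - z c| ≤ r c).card ≤ 2 := by
  have key : ∀ c ∈ S, |p - z c| ≤ r c → ∀ c' ∈ S, (c ≤ c' ∧ c' ≤ p ∨ p ≤ c' ∧ c' ≤ c) →
      c' = c := by
    intro c hc hp c' hc' h
    have h3 := abs_le.1 (h1 c hc)
    have h4 := abs_le.1 hp
    refine h2 c hc c' hc' (abs_le.2 ?_)
    rcases h with h | h <;> constructor <;> linarith
  rw [← Finset.card_filter_add_card_filter_not (s := S.filter fun c => |p - z c| ≤ r c)
    (fun c => c ≤ p)]
  refine Nat.add_le_add (b := 1) (d := 1) ?_ ?_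
  · refine Finset.card_le_one.2 fun c hc c' hc' => ?_
    simp only [Finset.mem_filter] at hc hc'
    rcases le_total c c' with h | h
    · exact (key c hc.1.1 hc.1.2 c' hc'.1.1 (Or.inl ⟨h, hc'.2⟩)).symm
    · exact key c' hc'.1.1 hc'.1.2 c hc.1.1 (Or.inl ⟨h, hc.2⟩)
  · refine Finset.card_le_one.2 fun c hc c' hc' => ?_
    simp only [Finset.mem_filter, not_le] at hc hc'
    rcases le_total c c' with h | h
    · exact key c' hc'.1.1 hc'.1.2 c hc.1.1 (Or.inr ⟨hc.2.le, h⟩)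
    · exact (key c hc.1.1 hc.1.2 c' hc'.1.1 (Or.inr ⟨hc'.2.le, h⟩)).symm

/-- Each step charges a point at most twice, so only a bound `f i` per step is needed. All three
charging arguments pass through this. -/
lemma sum_indicator_copies_le {E : Finset ℕ} {S : ℕ → Finset ℝ} {z r : ℕ → ℝ → ℝ}
    (h1 : ∀ i ∈ E, ∀ c ∈ S i, |c - z i c| ≤ r i c)
    (h2 : ∀ i ∈ E, ∀ c ∈ S i, ∀ c' ∈ S i, |c' - z i c| ≤ r i c → c' = c)
    (Q : (Σ _ : ℕ, ℝ) → Prop) [DecidablePred Q] (W : (Σ _ : ℕ, ℝ) → Set Point)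
    (w : (Σ _ : ℕ, ℝ) → ℝ) (f : ℕ → ℝ) (p : Point) (hf : ∀ i ∈ E, 0 ≤ f i)
    (h : ∀ i ∈ E, ∀ c ∈ S i, Q ⟨i, c⟩ → p ∈ W ⟨i, c⟩ → |p.1 - z i c| ≤ r i c ∧ w ⟨i, c⟩ ≤ f i) :
    ∑ e ∈ (E.sigma S).filter Q, (W e).indicator (fun _ => w e) p ≤ 2 * ∑ i ∈ E, f i := by
  classical
  calc ∑ e ∈ (E.sigma S).filter Q, (W e).indicator (fun _ => w e) p
      ≤ ∑ e ∈ E.sigma S, if |p.1 - z e.1 e.2| ≤ r e.1 e.2 then f e.1 else 0 := by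
        rw [Finset.sum_filter]
        refine Finset.sum_le_sum fun e he => ?_
        obtain ⟨hi, hc⟩ := Finset.mem_sigma.1 he
        have h0 : (0 : ℝ) ≤ if |p.1 - z e.1 e.2| ≤ r e.1 e.2 then f e.1 else 0 := by
          split_ifs
          · exact hf _ hi
          · exact le_rfl
        by_cases hQ : Q e
        · rw [if_pos hQ]
          by_cases hp : p ∈ W e
          · obtain ⟨h3, h4⟩ := h e.1 hi e.2 hc hQ hp
            rw [indicator_of_mem hp, if_pos h3]
            exact h4
          · rwa [indicator_of_notMem hp]
        · rwa [if_neg hQ]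
    _ = ∑ i ∈ E, ((S i).filter fun c => |p.1 - z i c| ≤ r i c).card * f i := by
        rw [Finset.sum_sigma]
        refine Finset.sum_congr rfl fun i _ => ?_
        dsimp only
        rw [← Finset.sum_filter, Finset.sum_const, nsmul_eq_mul]
    _ ≤ ∑ i ∈ E, 2 * f i := by
        refine Finset.sum_le_sum fun i hi => mul_le_mul_of_nonneg_right ?_ (hf i hi)
        exact_mod_cast card_filter_irredundant_le (h1 i hi) (h2 i hi) p.1
    _ = _ := (Finset.mul_sum _ _ _).symm

/-- As `a` is at least both `θ` and a fifth of the height above `p`, the sum of the quotients is a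
discrete form of ∫ dt / (θ + (t - p)/5). The step that straddles `p` accounts for the summand 1. -/
lemma exists_log_weights {Y : ℕ → ℝ} (hY : Monotone Y) {θ : ℝ} (hθ : 0 < θ) (p : ℝ) (hp : 0 ≤ p) :
    ∃ g : ℕ → ℝ, (∀ i, 0 ≤ g i) ∧
      (∀ i a, p ≤ Y (i + 1) → θ ≤ a → Y (i + 1) - Y i ≤ a → Y (i + 1) - p ≤ 5 * a →
        (Y (i + 1) - Y i) / a ≤ g i) ∧
      ∀ n, 0 ≤ Y n → ∑ i ∈ Finset.range n, g i ≤ 1 + 10 * Real.log ((θ + Y n) / θ) := by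
  classical
  set φ : ℝ → ℝ := fun t => Real.log (θ + (t - p) / 5) with hφ
  have hφmono : ∀ s t, p ≤ s → s ≤ t → φ s ≤ φ t := fun s t h1 h2 =>
    Real.log_le_log (by linarith) (by linarith)
  refine ⟨fun i => if p ≤ Y (i + 1) then if Y i < p then 1 else 10 * (φ (Y (i + 1)) - φ (Y i))
    else 0, fun i => ?_, fun i a h1 h2 h3 h4 => ?_, fun n hn => ?_⟩
  · dsimp only
    split_ifs with h1 h2
    · exact zero_le_one
    · have := hφmono _ _ (not_lt.1 h2) (hY i.le_succ)
      linarith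
    · exact le_rfl
  · dsimp only
    have ha : 0 < a := hθ.trans_le h2
    rw [if_pos h1]
    split_ifs with h5
    · exact (div_le_one ha).2 h3
    · have h6 := hY i.le_succ
      simp only [Nat.succ_eq_add_one] at h6
      push Not at h5
      have hA : 0 < θ + (Y i - p) / 5 := by linarith
      have hB : 0 < θ + (Y (i + 1) - p) / 5 := by linarith
      have h7 := Real.log_le_sub_one_of_pos (div_pos hA hB)
      rw [Real.log_div hA.ne' hB.ne'] at h7
      have h8 : (θ + (Y i - p) / 5) / (θ + (Y (i + 1) - p) / 5) - 1 =
          -((Y (i + 1) - Y i) / 5 / (θ + (Y (i + 1) - p) / 5)) := by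
        rw [div_sub_one hB.ne', ← neg_div]
        congr 1
        ring
      -- The denominator on the right is at most `2 * a`; hence 10 = 2 · 5.
      have h9 : (Y (i + 1) - Y i) / a ≤ 10 * ((Y (i + 1) - Y i) / 5 / (θ + (Y (i + 1) - p) / 5)) := by
        rw [div_div, mul_div_assoc', div_le_div_iff₀ ha (by positivity)]
        have h10 : 0 ≤ Y (i + 1) - Y i := by linarith
        nlinarith
      simp only [hφ]
      linarith
  · have key : ∀ n, ∑ i ∈ Finset.range n, (if p ≤ Y (i + 1) then if Y i < p then 1 else
        10 * (φ (Y (i + 1)) - φ (Y i)) else 0) ≤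
        if Y n < p then 0 else 1 + 10 * (φ (Y n) - Real.log θ) := by
      intro n
      induction n with
      | zero =>
        rw [Finset.sum_range_zero]
        split_ifs with h
        · exact le_rfl
        · have := hφmono p _ le_rfl (not_lt.1 h)
          have h2 : φ p = Real.log θ := by simp [hφ]
          linarith
      | succ n ih =>
        rw [Finset.sum_range_succ]
        by_cases h1 : p ≤ Y (n + 1)
        · rw [if_pos h1, if_neg (not_lt.2 h1)]
          by_cases h2 : Y n < p
          · rw [if_pos h2] at ih ⊢
            have h3 := hφmono p _ le_rfl h1
            have h4 : φ p = Real.log θ := by simp [hφ]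
            linarith
          · rw [if_neg h2] at ih ⊢
            linarith
        · rw [if_neg h1, if_pos (not_le.1 h1)]
          have h2 := hY n.le_succ
          simp only [Nat.succ_eq_add_one] at h2
          rw [if_pos (by linarith)] at ih
          linarith
    refine (key n).trans ?_
    have h0 : 0 ≤ Real.log ((θ + Y n) / θ) :=
      Real.log_nonneg ((one_le_div hθ).2 (by linarith))
    split_ifs with h
    · linarith
    · rw [Real.log_div (by positivity) hθ.ne']
      have : φ (Y n) ≤ Real.log (θ + Y n) := Real.log_le_log (by linarith) (by linarith)
      linarith

/-- Clamping `Y` to `[s, t]` leaves the counted increments unchanged, and the clamped increments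
telescope. -/
lemma sum_filter_step_le {Y : ℕ → ℝ} (hY : Monotone Y) {E : Finset ℕ} {n : ℕ}
    (hE : E ⊆ Finset.range n) {s t : ℝ} (hst : s ≤ t) :
    ∑ i ∈ E, (if s ≤ Y i ∧ Y (i + 1) ≤ t then Y (i + 1) - Y i else 0) ≤ t - s := by
  have hcl : Monotone fun i => min (max (Y i) s) t := fun i j h =>
    min_le_min_right _ (max_le_max_right _ (hY h))
  calc ∑ i ∈ E, (if s ≤ Y i ∧ Y (i + 1) ≤ t then Y (i + 1) - Y i else 0)
      ≤ ∑ i ∈ E, (min (max (Y (i + 1)) s) t - min (max (Y i) s) t) := by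
        refine Finset.sum_le_sum fun i _ => ?_
        have h0 := hY i.le_succ
        have h1 := hcl i.le_succ
        simp only [Nat.succ_eq_add_one] at h0 h1
        split_ifs with h
        · rw [max_eq_left h.1, max_eq_left (h.1.trans h0), min_eq_left h.2,
            min_eq_left (h0.trans h.2)]
        · linarith
    _ ≤ ∑ i ∈ Finset.range n, (min (max (Y (i + 1)) s) t - min (max (Y i) s) t) :=
        Finset.sum_le_sum_of_subset_of_nonneg hE fun i _ _ => sub_nonneg.2 (hcl i.le_succ)
    _ = min (max (Y n) s) t - min (max (Y 0) s) t :=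
        Finset.sum_range_sub (fun i => min (max (Y i) s) t) n
    _ ≤ t - s := sub_le_sub (min_le_right _ _) (le_min (le_max_right _ _) hst)

lemma sum_strip_le_one {Y : ℕ → ℝ} (hY : Monotone Y) (E : Finset ℕ) (p : ℝ) :
    ∑ i ∈ E, (if p ∈ Ioc (Y i) (Y (i + 1)) then (1 : ℝ) else 0) ≤ 1 := by
  classical
  rw [← Finset.sum_filter, Finset.sum_const, nsmul_eq_mul, mul_one]
  have : (E.filter fun i => p ∈ Ioc (Y i) (Y (i + 1))).card ≤ 1 := by
    refine Finset.card_le_one.2 fun i hi j hj => ?_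
    obtain ⟨-, hi1, hi2⟩ := Finset.mem_filter.1 hi
    obtain ⟨-, hj1, hj2⟩ := Finset.mem_filter.1 hj
    by_contra hne
    rcases lt_or_gt_of_ne hne with h | h
    · linarith [hY (Nat.succ_le_of_lt h)]
    · linarith [hY (Nat.succ_le_of_lt h)]
  exact_mod_cast this

/-- The total length of the copies that are kept by an irredundant strategy. -/
theorem sum_copies_le {F : Finset Seg} {E : Finset ℕ} {n : ℕ} {Y x ρ : ℕ → ℝ}
    {S : ℕ → Finset ℝ} {z a : ℕ → ℝ → ℝ} {j : ℕ → ℝ → ℕ} {θ δ M : ℝ}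
    (hY : Monotone Y) (hY0 : 0 ≤ Y 0) (hE : E ⊆ Finset.range n) (hδ : 1 ≤ δ) (hθ : 0 < θ)
    (hρ : ∀ i ∈ E, 0 ≤ ρ i) (hreach : ∀ i ∈ E, Reachable F (x i, Y (i + 1)))
    (hj : ∀ i ∈ E, ∀ c ∈ S i, j i c ∈ E ∧ j i c < i ∧ θ ≤ a i c ∧
      Y (i + 1) - a i c ≤ Y (j i c + 1) ∧ |z i c - x (j i c)| ≤ ρ (j i c) + a i c ∧
      4 * δ * a i c < z i c)
    (h1 : ∀ i ∈ E, ∀ c ∈ S i, |c - z i c| ≤ 4 * δ * a i c)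
    (h2 : ∀ i ∈ E, ∀ c ∈ S i, ∀ c' ∈ S i, |c' - z i c| ≤ 4 * δ * a i c → c' = c)
    (hM : cost F + 2 * ∑ i ∈ E, ρ i ≤ M) :
    ∑ i ∈ E, (Y (i + 1) - Y i) * (S i).card ≤
      (18 + 2 * (1 / δ * (1 + 10 * Real.log ((θ + Y n) / θ)))) * M := by
  classical
  have hYn : ∀ i, 0 ≤ Y i := fun i => hY0.trans (hY (Nat.zero_le i))
  have hτ : ∀ i, 0 ≤ Y (i + 1) - Y i := fun i => sub_nonneg.2 (hY i.le_succ)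
  have hδ0 : 0 < δ := one_pos.trans_le hδ
  have hM0 : 0 ≤ M := le_trans
    (add_nonneg (cost_nonneg F) (mul_nonneg two_pos.le (Finset.sum_nonneg hρ))) hM
  -- The solution together with the widened requests; its length is at most `M`, and all charges go
  -- to its points.
  set U : Set Point := region F ∪
    ⋃ i ∈ E, segment ℝ ((x i - ρ i, Y (i + 1)) : Point) (x i + ρ i, Y (i + 1)) with hU
  have hUM : μH[1] U ≤ ENNReal.ofReal M := by
    refine (measure_union_le _ _).trans ((add_le_add (hausdorffMeasure_region_le F)
      (measure_biUnion_finset_le _ _)).trans ?_)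
    refine (add_le_add le_rfl (Finset.sum_le_sum (g := fun i => ENNReal.ofReal (2 * ρ i))
      fun i hi => ?_)).trans ?_
    · refine (hausdorffMeasure_segment_le _ _).trans (ENNReal.ofReal_le_ofReal ?_)
      have h : x i + ρ i - (x i - ρ i) = 2 * ρ i := by ring
      simp only [sub_self, abs_zero, add_zero, h]
      rw [abs_of_nonneg (mul_nonneg two_pos.le (hρ i hi))]
    · rw [← ENNReal.ofReal_sum_of_nonneg fun i hi => mul_nonneg two_pos.le (hρ i hi),
        ← ENNReal.ofReal_add (cost_nonneg F)
          (Finset.sum_nonneg fun i hi => mul_nonneg two_pos.le (hρ i hi)), ← Finset.mul_sum]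
      exact ENNReal.ofReal_le_ofReal hM
  have hU0 : ∀ p ∈ U, 0 ≤ p.2 := by
    rintro p (hp | hp)
    · exact (nonneg_of_mem_region hp).2
    · simp only [mem_iUnion] at hp
      obtain ⟨i, -, hp⟩ := hp
      rw [(mem_segment_horizontal.1 hp).2]
      exact hYn _
  have ha0 : ∀ i ∈ E, ∀ c ∈ S i, 0 < a i c := fun i hi c hc =>
    hθ.trans_le (hj i hi c hc).2.2.1
  set J : (Σ _ : ℕ, ℝ) → Set ℝ := fun e =>
    Icc (z e.1 e.2 - 4 * δ * a e.1 e.2) (z e.1 e.2 + 4 * δ * a e.1 e.2) with hJ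
  have hmemJ : ∀ (i : ℕ) (c : ℝ) (t : ℝ), t ∈ J ⟨i, c⟩ → |t - z i c| ≤ 4 * δ * a i c := by
    rintro i c t ⟨h3, h4⟩
    exact abs_le.2 ⟨by linarith, by linarith⟩
  set Q₁ : (Σ _ : ℕ, ℝ) → Prop := fun e => ENNReal.ofReal (δ * a e.1 e.2) ≤
    μH[1] (U ∩ (J e ×ˢ Icc (Y (e.1 + 1) - 5 * a e.1 e.2) (Y (e.1 + 1)))) with hQ₁
  set Q₂ : (Σ _ : ℕ, ℝ) → Prop := fun e => ENNReal.ofReal (Y (e.1 + 1) - Y e.1) ≤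
    μH[1] (U ∩ (J e ×ˢ Ioc (Y e.1) (Y (e.1 + 1)))) with hQ₂
  -- The conditions stand inside the existential so that `choose` yields a total function; ∅ is a
  -- dummy where they fail.
  have hcase : ∀ e : (Σ _ : ℕ, ℝ), ∃ W : Set Point, e ∈ E.sigma S → ¬ Q₁ e → ¬ Q₂ e →
      MeasurableSet W ∧ ENNReal.ofReal (a e.1 e.2) ≤ μH[1] (U ∩ W) ∧
      ∀ p ∈ W, p.1 ∈ J e ∧
        p.2 ∈ Icc (Y (e.1 + 1) - 4 * a e.1 e.2) (Y (e.1 + 1) - 3 * a e.1 e.2) ∧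
        Relation.ReflTransGen (Step F) p (x (j e.1 e.2), Y (j e.1 e.2 + 1)) ∧
        ∀ r : Point, Y (e.1 + 1) < r.2 → ¬ Relation.ReflTransGen (Step F) p r := by
    rintro ⟨i, c⟩
    by_cases he : (⟨i, c⟩ : Σ _ : ℕ, ℝ) ∈ E.sigma S
    · obtain ⟨hi, hc⟩ := Finset.mem_sigma.1 he
      obtain ⟨h3, h4, h5, h6, h7, h8⟩ := hj i hi c hc
      rcases length_near_copy (U := U) (y₀ := Y i) (y₁ := Y (i + 1)) subset_union_left
        ((subset_biUnion_of_mem (u := fun i => segment ℝ ((x i - ρ i, Y (i + 1)) : Point)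
          (x i + ρ i, Y (i + 1))) h3).trans subset_union_right) (hreach _ h3) hδ (ha0 i hi c hc)
        h6 (hY h4) (hY i.le_succ) h7 h8 with h | h | ⟨W, hW⟩
      · exact ⟨∅, fun _ h' => absurd h h'⟩
      · exact ⟨∅, fun _ _ h' => absurd h h'⟩
      · exact ⟨W, fun _ _ _ => hW⟩
    · exact ⟨∅, fun h => absurd h he⟩
  choose W hW using hcase
  -- A copy of length τ spreads over length `δ * a` with density `τ / (δ * a)`; the densities at one
  -- point sum to a logarithm divided by `δ`.
  have hwide : ∑ e ∈ (E.sigma S).filter Q₁, (Y (e.1 + 1) - Y e.1) ≤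
      2 * (1 / δ * (1 + 10 * Real.log ((θ + Y n) / θ))) * M := by
    have hlog : 0 ≤ Real.log ((θ + Y n) / θ) :=
      Real.log_nonneg ((one_le_div hθ).2 (by linarith [hYn n]))
    have := sum_mul_le_of_charge (A := U) (M := M)
      (C := 2 * (1 / δ * (1 + 10 * Real.log ((θ + Y n) / θ)))) hUM hM0 (by positivity)
      ((E.sigma S).filter Q₁)
      (fun e => J e ×ˢ Icc (Y (e.1 + 1) - 5 * a e.1 e.2) (Y (e.1 + 1)))
      (fun e => (Y (e.1 + 1) - Y e.1) / (δ * a e.1 e.2)) (fun e => δ * a e.1 e.2)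
      (fun _ _ => measurableSet_Icc.prod measurableSet_Icc)
      (fun e he => div_nonneg (hτ _) (mul_nonneg hδ0.le
        (ha0 _ (Finset.mem_sigma.1 (Finset.mem_filter.1 he).1).1 _
          (Finset.mem_sigma.1 (Finset.mem_filter.1 he).1).2).le))
      (fun e he => mul_nonneg hδ0.le
        (ha0 _ (Finset.mem_sigma.1 (Finset.mem_filter.1 he).1).1 _
          (Finset.mem_sigma.1 (Finset.mem_filter.1 he).1).2).le)
      (fun e he => (Finset.mem_filter.1 he).2) (by
        intro p hp
        obtain ⟨g, hg0, hg, hgsum⟩ := exists_log_weights hY hθ p.2 (hU0 p hp)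
        refine (sum_indicator_copies_le h1 h2 Q₁ _ _ (fun i => 1 / δ * g i) p
          (fun i _ => mul_nonneg (by positivity) (hg0 i)) ?_).trans ?_
        · rintro i hi c hc - ⟨hp1, hp2, hp3⟩
          refine ⟨hmemJ i c _ hp1, ?_⟩
          obtain ⟨h3, h4, h5, h6, -, -⟩ := hj i hi c hc
          have h7 := hY h4
          simp only at hp2 hp3
          have h8 := hg i (a i c) hp3 h5 (by simp only [Nat.succ_eq_add_one] at h7; linarith)
            (by linarith)
          calc (Y (i + 1) - Y i) / (δ * a i c) = 1 / δ * ((Y (i + 1) - Y i) / a i c) := by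
                rw [div_mul_div_comm, one_mul]
            _ ≤ 1 / δ * g i := mul_le_mul_of_nonneg_left h8 (by positivity)
        · rw [← Finset.mul_sum]
          refine mul_le_mul_of_nonneg_left (mul_le_mul_of_nonneg_left ?_ (by positivity)) two_pos.le
          exact (Finset.sum_le_sum_of_subset_of_nonneg hE fun i _ _ => hg0 i).trans
            (hgsum n (hYn n)))
    refine le_trans (le_of_eq (Finset.sum_congr rfl fun e he => ?_)) this
    have h3 := ha0 _ (Finset.mem_sigma.1 (Finset.mem_filter.1 he).1).1 _
          (Finset.mem_sigma.1 (Finset.mem_filter.1 he).1).2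
    exact (div_mul_cancel₀ _ (mul_pos hδ0 h3).ne').symm
  -- A point is charged only by the one step whose strip contains its height.
  have halive : ∑ e ∈ ((E.sigma S).filter fun e => ¬ Q₁ e).filter Q₂, (Y (e.1 + 1) - Y e.1) ≤
      2 * M := by
    rw [Finset.filter_filter]
    have := sum_mul_le_of_charge (A := U) (M := M) (C := 2) hUM hM0 two_pos.le
      ((E.sigma S).filter fun e => ¬ Q₁ e ∧ Q₂ e)
      (fun e => J e ×ˢ Ioc (Y e.1) (Y (e.1 + 1))) (fun _ => 1) (fun e => Y (e.1 + 1) - Y e.1)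
      (fun _ _ => measurableSet_Icc.prod measurableSet_Ioc) (fun _ _ => zero_le_one)
      (fun e _ => hτ _) (fun e he => (Finset.mem_filter.1 he).2.2) (by
        intro p hp
        refine (sum_indicator_copies_le h1 h2 _ _ _
          (fun i => if p.2 ∈ Ioc (Y i) (Y (i + 1)) then (1 : ℝ) else 0) p
          (fun i _ => by split_ifs <;> norm_num) ?_).trans ?_
        · rintro i hi c hc - ⟨hp1, hp2⟩
          exact ⟨hmemJ i c _ hp1, by rw [if_pos hp2]⟩
        · linarith [sum_strip_le_one hY E p.2])
    simpa using this
  have hdead : ∑ e ∈ ((E.sigma S).filter fun e => ¬ Q₁ e).filter fun e => ¬ Q₂ e,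
      (Y (e.1 + 1) - Y e.1) ≤ 16 * M := by
    rw [Finset.filter_filter]
    set D := (E.sigma S).filter fun e => ¬ Q₁ e ∧ ¬ Q₂ e with hD
    have hWD : ∀ e ∈ D, _ := fun e he =>
      hW e (Finset.mem_filter.1 he).1 (Finset.mem_filter.1 he).2.1 (Finset.mem_filter.1 he).2.2
    have haD : ∀ e ∈ D, 0 < a e.1 e.2 := fun e he =>
      ha0 _ (Finset.mem_sigma.1 (Finset.mem_filter.1 he).1).1 _
        (Finset.mem_sigma.1 (Finset.mem_filter.1 he).1).2
    have := sum_mul_le_of_charge (A := U) (M := M) (C := 16) hUM hM0 (by norm_num) D W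
      (fun e => (Y (e.1 + 1) - Y e.1) / a e.1 e.2) (fun e => a e.1 e.2)
      (fun e he => (hWD e he).1) (fun e he => div_nonneg (hτ _) (haD e he).le)
      (fun e he => (haD e he).le) (fun e he => (hWD e he).2.1) (by
        intro p hp
        by_cases hne : (D.filter fun e => p ∈ W e).Nonempty
        swap
        · rw [Finset.not_nonempty_iff_eq_empty, Finset.filter_eq_empty_iff] at hne
          rw [Finset.sum_eq_zero fun e he => indicator_of_notMem (hne he) _]
          norm_num
        -- After the earliest step that charges `p`, no higher point is reached from `p`. The
        -- request used by any later charging step is reached from `p`, so it is at most `d` above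
        -- `p`. This forces `d / 4 ≤ a` and keeps all charging strips within height `2 * d` above
        -- `p`, whence the bound 2 · (4/d) · 2d = 16.
        obtain ⟨e₁, he₁, hmin⟩ := Finset.exists_min_image _ (fun e => e.1) hne
        obtain ⟨he₁D, hpe₁⟩ := Finset.mem_filter.1 he₁
        obtain ⟨-, ⟨-, hp₁⟩, -, hdie⟩ := (hWD e₁ he₁D).2.2 p hpe₁
        have ha₁ := haD e₁ he₁D
        set d := Y (e₁.1 + 1) - p.2 with hd
        have hd0 : 0 < d := by linarith
        refine (sum_indicator_copies_le h1 h2 (fun e => ¬ Q₁ e ∧ ¬ Q₂ e) W _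
          (fun i => 4 / d * if p.2 ≤ Y i ∧ Y (i + 1) ≤ p.2 + 2 * d then Y (i + 1) - Y i else 0) p
          (fun i _ => mul_nonneg (by positivity) (by split_ifs; exacts [hτ i, le_rfl]))
          ?_).trans ?_
        · intro i hi c hc hQ hpW
          have heD : (⟨i, c⟩ : Σ _ : ℕ, ℝ) ∈ D :=
            Finset.mem_filter.2 ⟨Finset.mem_sigma.2 ⟨hi, hc⟩, hQ⟩
          obtain ⟨hpJ, ⟨hp2, hp3⟩, hpath, -⟩ := (hWD _ heD).2.2 p hpW
          have hi1 : e₁.1 ≤ i := hmin _ (Finset.mem_filter.2 ⟨heD, hpW⟩)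
          have hY1 := hY (Nat.succ_le_succ hi1)
          obtain ⟨h3, h4, h5, h6, -, -⟩ := hj i hi c hc
          have ha := haD _ heD
          have hji : Y (j i c + 1) ≤ Y i := hY h4
          have hjd : Y (j i c + 1) ≤ Y (e₁.1 + 1) := by
            by_contra! hlt
            exact hdie _ hlt hpath
          simp only [Nat.succ_eq_add_one] at hp2 hp3 hY1 ha
          refine ⟨hmemJ i c _ hpJ, ?_⟩
          rw [if_pos ⟨by linarith, by linarith⟩, div_mul_eq_mul_div, div_le_div_iff₀ ha hd0]
          nlinarith [hτ i]
        · rw [← Finset.mul_sum]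
          have h3 := sum_filter_step_le hY hE (s := p.2) (t := p.2 + 2 * d) (by linarith)
          rw [add_sub_cancel_left] at h3
          calc _ ≤ 2 * (4 / d * (2 * d)) := by gcongr
            _ = 16 := by field_simp; norm_num)
    refine le_trans (le_of_eq (Finset.sum_congr rfl fun e he => ?_)) this
    exact (div_mul_cancel₀ _ (haD e he).ne').symm
  have hsum : ∑ i ∈ E, (Y (i + 1) - Y i) * (S i).card =
      ∑ e ∈ E.sigma S, (Y (e.1 + 1) - Y e.1) := by
    rw [Finset.sum_sigma]
    refine Finset.sum_congr rfl fun i _ => ?_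
    simp only [Finset.sum_const, nsmul_eq_mul]
    ring
  rw [hsum, ← Finset.sum_filter_add_sum_filter_not (E.sigma S) Q₁,
    ← Finset.sum_filter_add_sum_filter_not ((E.sigma S).filter fun e => ¬ Q₁ e) Q₂]
  linarith

/-! ### The algorithm. -/

/-- The backward distance of the point `(x, y)` from the origin and the widened requests of
`base`: a request `b.1` stands for the horizontal segment of radius `b.2` around it. -/
noncomputable def baseDist (base : List (Point × ℝ)) (y x : ℝ) : ℝ :=
  base.foldr (fun b d => min (max (|x - b.1.1| - b.2) (y - b.1.2)) d) (max |x| y)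

lemma baseDist_cons (b : Point × ℝ) (base : List (Point × ℝ)) (y x : ℝ) :
    baseDist (b :: base) y x =
      min (max (|x - b.1.1| - b.2) (y - b.1.2)) (baseDist base y x) := rfl

lemma baseDist_le_max (base : List (Point × ℝ)) (y x : ℝ) : baseDist base y x ≤ max |x| y := by
  induction base with
  | nil => exact le_rfl
  | cons b base ih => exact (min_le_right _ _).trans ih

lemma baseDist_le_of_mem {base : List (Point × ℝ)} {b : Point × ℝ} (hb : b ∈ base) (y x : ℝ) :
    baseDist base y x ≤ max (|x - b.1.1| - b.2) (y - b.1.2) := by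
  induction base with
  | nil => simp at hb
  | cons b' base ih =>
    rcases List.mem_cons.1 hb with rfl | h
    · exact min_le_left _ _
    · exact (min_le_right _ _).trans (ih h)

lemma baseDist_eq (base : List (Point × ℝ)) (y x : ℝ) :
    baseDist base y x = max |x| y ∨
      ∃ b ∈ base, baseDist base y x = max (|x - b.1.1| - b.2) (y - b.1.2) := by
  induction base with
  | nil => exact Or.inl rfl
  | cons b base ih =>
    rw [baseDist_cons]
    rcases min_choice (max (|x - b.1.1| - b.2) (y - b.1.2)) (baseDist base y x) with h | h
    · exact Or.inr ⟨b, List.mem_cons_self, h⟩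
    · rw [h]
      exact ih.imp_right fun ⟨b', hb', h'⟩ => ⟨b', List.mem_cons_of_mem _ hb', h'⟩

lemma baseDist_mono (base : List (Point × ℝ)) {y y' : ℝ} (h : y ≤ y') (x : ℝ) :
    baseDist base y x ≤ baseDist base y' x := by
  induction base with
  | nil => exact max_le_max_left _ h
  | cons b base ih => exact min_le_min (max_le_max_left _ (by linarith)) ih

lemma baseDist_nonneg {base : List (Point × ℝ)} {y : ℝ} (h : ∀ b ∈ base, b.1.2 ≤ y) (x : ℝ) :
    0 ≤ baseDist base y x := by
  rcases baseDist_eq base y x with h1 | ⟨b, hb, h1⟩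
  · rw [h1]
    exact (abs_nonneg x).trans (le_max_left _ _)
  · rw [h1]
    exact (sub_nonneg.2 (h b hb)).trans (le_max_right _ _)

/-- The scales of a list of requests: the doubly logarithmic scale of their number and the
optimal cost, rounded up to a power of two. -/
noncomputable def scale (R : List Point) : ℕ × ℝ :=
  (Nat.clog 2 (Nat.clog 2 R.length), if opt R = 0 then 0 else (2 : ℝ) ^ Int.clog 2 (opt R))

/-- The sparsity `δ` of the copies. -/
noncomputable def sparsity (κ : ℕ × ℝ) : ℝ := Real.sqrt (2 ^ κ.1)

/-- The smallest distance that is taken into account. -/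
noncomputable def resolution (κ : ℕ × ℝ) : ℝ := κ.2 / 2 ^ 2 ^ κ.1

lemma one_le_sparsity (κ : ℕ × ℝ) : 1 ≤ sparsity κ :=
  Real.one_le_sqrt.2 (one_le_pow₀ one_le_two)

/-- The radius around the position `x` in which a copy has to be kept until the height `y`. -/
noncomputable def radius (κ : ℕ × ℝ) (base : List (Point × ℝ)) (y x : ℝ) : ℝ :=
  4 * sparsity κ * max (baseDist base y x) (resolution κ)

/-- `S` contains the position `0` and meets all intervals of radius `rad x` around `x`. -/
def Hits (S : Finset ℝ) (rad : ℝ → ℝ) : Prop := 0 ∈ S ∧ ∀ x, 0 ≤ x → ∃ c ∈ S, |c - x| ≤ rad x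

/-- A hitting subset of minimum cardinality works. Removing 0 is not considered, as `Hits` demands
it. -/
lemma exists_irredundant {G : Finset ℝ} {rad : ℝ → ℝ} (hG : Hits G rad) :
    ∃ S ⊆ G, Hits S rad ∧ ∀ c ∈ S, c ≠ 0 → ¬ Hits (S.erase c) rad := by
  classical
  obtain ⟨S, hS, hmin⟩ := Finset.exists_min_image (G.powerset.filter fun S => Hits S rad)
    Finset.card ⟨G, Finset.mem_filter.2 ⟨Finset.mem_powerset_self G, hG⟩⟩
  obtain ⟨hSG, hhit⟩ := Finset.mem_filter.1 hS
  rw [Finset.mem_powerset] at hSG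
  refine ⟨S, hSG, hhit, fun c hc _ hcon => ?_⟩
  have h1 := hmin (S.erase c) (Finset.mem_filter.2
    ⟨Finset.mem_powerset.2 ((Finset.erase_subset _ _).trans hSG), hcon⟩)
  exact absurd (Finset.card_erase_lt_of_mem hc) (not_lt.2 h1)

open Classical in
/-- An irredundant subset of `G` that hits. -/
noncomputable def carry (G : Finset ℝ) (rad : ℝ → ℝ) : Finset ℝ :=
  if h : ∃ S ⊆ G, Hits S rad ∧ ∀ c ∈ S, c ≠ 0 → ¬ Hits (S.erase c) rad then h.choose else ∅

lemma carry_spec {G : Finset ℝ} {rad : ℝ → ℝ} (hG : Hits G rad) :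
    carry G rad ⊆ G ∧ Hits (carry G rad) rad ∧
      ∀ c ∈ carry G rad, c ≠ 0 → ¬ Hits ((carry G rad).erase c) rad := by
  rw [carry, dif_pos (exists_irredundant hG)]
  exact (exists_irredundant hG).choose_spec

open Classical in
/-- An element of `S` in the given radius around `x`. -/
noncomputable def nearby (S : Finset ℝ) (rad x : ℝ) : ℝ :=
  if h : ∃ c ∈ S, |c - x| ≤ rad then h.choose else 0

lemma nearby_spec {S : Finset ℝ} {rad x : ℝ} (h : ∃ c ∈ S, |c - x| ≤ rad) :
    nearby S rad x ∈ S ∧ |nearby S rad x - x| ≤ rad := by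
  rw [nearby, dif_pos h]
  exact h.choose_spec

/-- A finite `θ`-net in the nonnegative part of the interval of radius `ρ` around `x`. -/
noncomputable def net (x ρ θ : ℝ) : Finset ℝ :=
  (Finset.range (⌈2 * ρ / θ⌉₊ + 1)).image fun k : ℕ => max 0 (min (x - ρ + k * θ) (x + ρ))

lemma mem_net {x ρ θ c : ℝ} (hx : 0 ≤ x) (hρ : 0 ≤ ρ) (hθ : 0 ≤ θ) (hc : c ∈ net x ρ θ) :
    max 0 (x - ρ) ≤ c ∧ c ≤ x + ρ := by
  obtain ⟨k, -, rfl⟩ := Finset.mem_image.1 hc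
  have : 0 ≤ (k : ℝ) * θ := by positivity
  refine ⟨max_le_max_left _ (le_min ?_ ?_), max_le ?_ (min_le_right _ _)⟩ <;> linarith

lemma exists_mem_net {x ρ θ u : ℝ} (hθ : 0 < θ) (hu : 0 ≤ u) (h1 : x - ρ ≤ u) (h2 : u ≤ x + ρ) :
    ∃ c ∈ net x ρ θ, |c - u| ≤ θ := by
  have h3 : 0 ≤ (u - (x - ρ)) / θ := div_nonneg (by linarith) hθ.le
  set k := ⌊(u - (x - ρ)) / θ⌋₊ with hk
  have h4 : (k : ℝ) * θ ≤ u - (x - ρ) := (le_div_iff₀ hθ).1 (Nat.floor_le h3)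
  have h5 : u - (x - ρ) < (k + 1) * θ := (div_lt_iff₀ hθ).1 (Nat.lt_floor_add_one _)
  refine ⟨_, Finset.mem_image.2 ⟨k, Finset.mem_range.2 (Nat.lt_succ_of_le ?_), rfl⟩, ?_⟩
  · refine (Nat.floor_le_floor (b := 2 * ρ / θ) ?_).trans (Nat.floor_le_ceil _)
    exact div_le_div_of_nonneg_right (by linarith) hθ.le
  · rw [min_eq_left (by linarith), abs_le]
    constructor
    · have := le_max_right 0 (x - ρ + k * θ)
      linarith
    · have : max 0 (x - ρ + k * θ) ≤ u := max_le hu (by linarith)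
      linarith

/-- The state of the algorithm. -/
structure State where
  /-- the requests so far -/
  hist : List Point
  /-- the current scales -/
  key : ℕ × ℝ
  /-- the requests since the last change of the scales, with their distances -/
  base : List (Point × ℝ)
  /-- positions that are reached at the current height -/
  marks : Finset ℝ
  /-- the current height -/
  height : ℝ
  /-- the copies that were kept in the last step -/
  carried : Finset ℝ
  /-- the distance of the last request from the base -/
  dist : ℝ
  /-- the segments that were added in the last step -/
  added : Finset Seg

open Classical in
/-- The base that is used for the next request. -/
noncomputable def State.nextBase (st : State) (r : Point) : List (Point × ℝ) :=
  if scale (st.hist ++ [r]) = st.key then st.base else []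

/-- The copies that are kept until the next request. -/
noncomputable def State.nextCarried (st : State) (r : Point) : Finset ℝ :=
  carry st.marks (radius (scale (st.hist ++ [r])) (st.nextBase r) r.2)

/-- The distance of the next request from the base. -/
noncomputable def State.nextDist (st : State) (r : Point) : ℝ :=
  baseDist (st.nextBase r) r.2 r.1

/-- The copy that serves the next request. -/
noncomputable def State.server (st : State) (r : Point) : ℝ :=
  nearby (st.nextCarried r) (radius (scale (st.hist ++ [r])) (st.nextBase r) r.2 r.1) r.1

open Classical in
/-- The segments that are added for the next request: the copies are kept, the request is served,
and the segment of radius `nextDist` around the request is covered. -/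
noncomputable def State.nextAdded (st : State) (r : Point) : Finset Seg :=
  (st.nextCarried r).image (fun c => mkSeg (c, st.height) (c, r.2)) ∪
    {mkSeg (st.server r, r.2) (r.1, r.2), mkSeg (r.1, r.2) (max 0 (r.1 - st.nextDist r), r.2),
      mkSeg (r.1, r.2) (r.1 + st.nextDist r, r.2)}

open Classical in
/-- One step of the algorithm. -/
noncomputable def State.step (st : State) (r : Point) : State where
  hist := st.hist ++ [r]
  key := scale (st.hist ++ [r])
  base := (r, st.nextDist r) :: st.nextBase r
  marks := st.nextCarried r ∪ net r.1 (st.nextDist r) (resolution (scale (st.hist ++ [r])))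
  height := r.2
  carried := st.nextCarried r
  dist := st.nextDist r
  added := st.nextAdded r

/-- The state of the algorithm after the requests `R`. -/
noncomputable def run (R : List Point) : State :=
  R.foldl State.step ⟨[], (0, 0), [], {0}, 0, {0}, 0, ∅⟩

lemma run_append (R : List Point) (r : Point) : run (R ++ [r]) = (run R).step r := by
  simp [run, List.foldl_append]

/-- The algorithm. -/
noncomputable def algorithm : Strategy := fun R => (run R).added

lemma run_hist (R : List Point) : (run R).hist = R := by
  induction R using List.reverseRecOn with
  | nil => rfl
  | append_singleton R r ih => rw [run_append]; simp [State.step, ih]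

lemma scale_snd_nonneg (R : List Point) : 0 ≤ (scale R).2 := by
  simp only [scale]
  split_ifs
  · exact le_rfl
  · positivity

lemma resolution_scale_nonneg (R : List Point) : 0 ≤ resolution (scale R) :=
  div_nonneg (scale_snd_nonneg R) (by positivity)

/-! ### Correctness of the algorithm. -/

/-- The invariants of the algorithm. -/
structure Invariant (R : List Point) : Prop where
  height_nonneg : 0 ≤ (run R).height
  le_height : ∀ q ∈ R, q.2 ≤ (run R).height
  height_le : ∀ t, 0 ≤ t → (∀ q ∈ R, q.2 ≤ t) → (run R).height ≤ t
  marks_nonneg : ∀ c ∈ (run R).marks, 0 ≤ c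
  marks_reachable : ∀ c ∈ (run R).marks, Reachable (algorithm.solution R) (c, (run R).height)
  hits : ∀ y, (run R).height ≤ y → Hits (run R).marks (radius (run R).key (run R).base y)
  base_le : ∀ b ∈ (run R).base, b.1.2 ≤ (run R).height

/-- With an empty base the copy at 0 hits everything, so a new phase can start without any further
copies. -/
lemma abs_le_radius_nil (κ : ℕ × ℝ) (y x : ℝ) : |x| ≤ radius κ [] y x := by
  have h1 : |x| ≤ max (baseDist [] y x) (resolution κ) :=
    (le_max_left |x| y).trans (le_max_left _ _)
  have h2 := one_le_sparsity κ
  have h3 := abs_nonneg x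
  unfold radius
  nlinarith

lemma Invariant.nil : Invariant [] where
  height_nonneg := le_rfl
  le_height := by simp
  height_le := fun t ht _ => ht
  marks_nonneg := by simp [run]
  marks_reachable := by
    intro c hc
    simp only [run, List.foldl_nil, Finset.mem_singleton] at hc
    subst hc
    exact .refl
  hits := fun y _ => ⟨by simp [run], fun x _ => ⟨0, by simp [run], by
    rw [zero_sub, abs_neg]
    exact abs_le_radius_nil _ y x⟩⟩
  base_le := by simp [run]

lemma Invariant.hits_next {R : List Point} (h : Invariant R) {r : Point}
    (hr : (run R).height ≤ r.2) :
    Hits (run R).marks (radius (scale (R ++ [r])) ((run R).nextBase r) r.2) := by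
  unfold State.nextBase
  rw [run_hist]
  split_ifs with hk
  · rw [hk]
    exact h.hits r.2 hr
  · exact ⟨(h.hits r.2 hr).1, fun x _ => ⟨0, (h.hits r.2 hr).1, by
      simpa using abs_le_radius_nil _ r.2 x⟩⟩

lemma Invariant.nextBase_le {R : List Point} (h : Invariant R) {r : Point}
    (hr : (run R).height ≤ r.2) : ∀ b ∈ (run R).nextBase r, b.1.2 ≤ r.2 := by
  intro b hb
  unfold State.nextBase at hb
  split_ifs at hb
  · exact (h.base_le b hb).trans hr
  · simp at hb

lemma Invariant.nextDist_nonneg {R : List Point} (h : Invariant R) {r : Point}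
    (hr : (run R).height ≤ r.2) : 0 ≤ (run R).nextDist r :=
  baseDist_nonneg (h.nextBase_le hr) _

lemma Invariant.carried_spec {R : List Point} (h : Invariant R) {r : Point}
    (hr : (run R).height ≤ r.2) : (run R).nextCarried r ⊆ (run R).marks ∧
      Hits ((run R).nextCarried r) (radius (scale (R ++ [r])) ((run R).nextBase r) r.2) ∧
      ∀ c ∈ (run R).nextCarried r, c ≠ 0 → ¬ Hits (((run R).nextCarried r).erase c)
        (radius (scale (R ++ [r])) ((run R).nextBase r) r.2) := by
  unfold State.nextCarried
  rw [run_hist]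
  exact carry_spec (h.hits_next hr)

lemma Invariant.server_spec {R : List Point} (h : Invariant R) {r : Point}
    (hr : (run R).height ≤ r.2) (hr0 : 0 ≤ r.1) : (run R).server r ∈ (run R).nextCarried r ∧
      |(run R).server r - r.1| ≤ radius (scale (R ++ [r])) ((run R).nextBase r) r.2 r.1 := by
  unfold State.server
  rw [run_hist]
  exact nearby_spec ((h.carried_spec hr).2.1.2 r.1 hr0)

lemma Invariant.height_le_next {R : List Point} (h : Invariant R) {r : Point}
    (hR : IsInstance (R ++ [r])) : (run R).height ≤ r.2 :=
  h.height_le _ (hR.nonneg r (by simp)).2 fun q hq =>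
    (List.pairwise_append.1 hR.sorted).2.2 q hq r (by simp)

/-- The degenerate phase, where the resolution is 0 and the net gives no approximation: only the
origin can have been requested. -/
lemma eq_zero_of_opt_eq_zero {R : List Point} (hR : IsInstance R) (h : opt R = 0) {r : Point}
    (hr : r ∈ R) : r = (0, 0) := by
  have h1 := hR.nonneg r hr
  have h2 := fst_le_opt hR.nonneg hr
  have h3 := snd_le_opt hR.nonneg hr
  rw [h] at h2 h3
  exact Prod.ext (le_antisymm h2 h1.1) (le_antisymm h3 h1.2)

lemma opt_eq_zero_of_scale {R : List Point} (h : (scale R).2 = 0) : opt R = 0 := by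
  by_contra hne
  simp only [scale, if_neg hne] at h
  have : (0 : ℝ) < 2 ^ Int.clog 2 (opt R) := by positivity
  linarith

lemma resolution_pos {R : List Point} (h : opt R ≠ 0) : 0 < resolution (scale R) := by
  refine div_pos (lt_of_le_of_ne (scale_snd_nonneg R) fun h' => h ?_) (by positivity)
  exact opt_eq_zero_of_scale h'.symm

/-- The copies that are kept reach the height of the next request, the request is served and the
points of the net around it are reached. -/
lemma Invariant.reachable_next {R : List Point} (h : Invariant R) {r : Point}
    (hR : IsInstance (R ++ [r])) :
    (∀ c ∈ (run R).nextCarried r, 0 ≤ c ∧ Reachable (algorithm.solution (R ++ [r])) (c, r.2)) ∧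
      Reachable (algorithm.solution (R ++ [r])) r ∧
      ∀ c, max 0 (r.1 - (run R).nextDist r) ≤ c → c ≤ r.1 + (run R).nextDist r →
        Reachable (algorithm.solution (R ++ [r])) (c, r.2) := by
  classical
  have hr := h.height_le_next hR
  have hr0 := hR.nonneg r (by simp)
  have hρ := h.nextDist_nonneg hr
  have hadd : ∀ s ∈ (run R).nextAdded r, s ∈ algorithm.solution (R ++ [r]) := by
    intro s hs
    rw [Strategy.solution_append_singleton]
    refine Finset.mem_union_right _ ?_
    simp only [algorithm, run_append]
    exact hs
  have h1 : ∀ c ∈ (run R).nextCarried r,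
      0 ≤ c ∧ Reachable (algorithm.solution (R ++ [r])) (c, r.2) := by
    intro c hc
    have hcm := (h.carried_spec hr).1 hc
    have hc0 := h.marks_nonneg c hcm
    refine ⟨hc0, ((h.marks_reachable c hcm).mono (algorithm.solution_subset_append _ _)).tail
      (step_vertical hc0 h.height_nonneg hr le_rfl (hadd _ (Finset.mem_union_left _ ?_)))⟩
    exact Finset.mem_image_of_mem (fun c => mkSeg (c, (run R).height) (c, r.2)) hc
  have h2 : Reachable (algorithm.solution (R ++ [r])) r := by
    obtain ⟨hs0, hs⟩ := h1 _ (h.server_spec hr hr0.1).1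
    have := hs.tail (step_horizontal hr0.2 hs0 hr0.1 (b := r.1) right_mem_uIcc
      (hadd _ (Finset.mem_union_right _ (by simp))))
    exact this
  refine ⟨h1, h2, fun c hc1 hc2 => ?_⟩
  rcases le_total c r.1 with hc | hc
  · refine h2.tail (step_horizontal (a := r.1) (c := max 0 (r.1 - (run R).nextDist r)) hr0.2 hr0.1
      (le_max_left _ _) ?_ (hadd _ (Finset.mem_union_right _ (by simp))))
    rw [uIcc_of_ge (hc1.trans hc)]
    exact ⟨hc1, hc⟩
  · refine h2.tail (step_horizontal (a := r.1) (c := r.1 + (run R).nextDist r) hr0.2 hr0.1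
      (by linarith) ?_ (hadd _ (Finset.mem_union_right _ (by simp))))
    rw [uIcc_of_le (hc.trans hc2)]
    exact ⟨hc, hc2⟩

lemma Invariant.append {R : List Point} (h : Invariant R) {r : Point}
    (hR : IsInstance (R ++ [r])) : Invariant (R ++ [r]) := by
  classical
  have hr := h.height_le_next hR
  have hr0 := hR.nonneg r (by simp)
  have hρ := h.nextDist_nonneg hr
  have hθ := resolution_scale_nonneg (R ++ [r])
  obtain ⟨hcarry, hserve, hnet⟩ := h.reachable_next hR
  have hmarks : (run (R ++ [r])).marks = (run R).nextCarried r ∪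
      net r.1 ((run R).nextDist r) (resolution (scale (R ++ [r]))) := by
    rw [run_append]
    simp only [State.step, run_hist]
  have hheight : (run (R ++ [r])).height = r.2 := by rw [run_append]; rfl
  have hkey : (run (R ++ [r])).key = scale (R ++ [r]) := by
    rw [run_append]
    simp only [State.step, run_hist]
  have hbase : (run (R ++ [r])).base = (r, (run R).nextDist r) :: (run R).nextBase r := by
    rw [run_append]; rfl
  have hmem : ∀ c ∈ (run (R ++ [r])).marks, 0 ≤ c ∧
      Reachable (algorithm.solution (R ++ [r])) (c, r.2) := by
    intro c hc
    rw [hmarks] at hc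
    rcases Finset.mem_union.1 hc with hc | hc
    · exact hcarry c hc
    · obtain ⟨h1, h2⟩ := mem_net hr0.1 hρ hθ hc
      exact ⟨(le_max_left _ _).trans h1, hnet c h1 h2⟩
  have hle : ∀ q ∈ R, q.2 ≤ r.2 := fun q hq => (h.le_height q hq).trans hr
  refine ⟨?_, ?_, ?_, fun c hc => (hmem c hc).1, ?_, ?_, ?_⟩
  · rw [hheight]
    exact hr0.2
  · rw [hheight]
    intro q hq
    rcases List.mem_append.1 hq with hq | hq
    · exact hle q hq
    · rw [List.mem_singleton.1 hq]
  · rw [hheight]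
    exact fun t _ ht => ht r (by simp)
  · rw [hheight]
    exact fun c hc => (hmem c hc).2
  · rw [hheight, hkey, hbase, hmarks]
    intro y hy
    obtain ⟨-, hhit, -⟩ := h.carried_spec hr
    refine ⟨Finset.mem_union_left _ hhit.1, fun x hx => ?_⟩
    have hs := one_le_sparsity (scale (R ++ [r]))
    -- If the new request determines the distance of `x`, its net supplies the mark. Otherwise a
    -- kept copy does, because the radii only grow with the height.
    rcases min_choice (max (|x - r.1| - (run R).nextDist r) (y - r.2))
      (baseDist ((run R).nextBase r) y x) with h1 | h1
    · have hD : baseDist ((r, (run R).nextDist r) :: (run R).nextBase r) y x =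
          max (|x - r.1| - (run R).nextDist r) (y - r.2) := h1
      set m := max (baseDist ((r, (run R).nextDist r) :: (run R).nextBase r) y x)
        (resolution (scale (R ++ [r]))) with hm
      have hm0 : 0 ≤ m := hθ.trans (le_max_right _ _)
      have hm1 : |x - r.1| - (run R).nextDist r ≤ m :=
        (le_max_left _ _).trans (hD.symm.le.trans (le_max_left _ _))
      have hrad : 2 * m ≤ radius (scale (R ++ [r]))
          ((r, (run R).nextDist r) :: (run R).nextBase r) y x := by
        unfold radius
        rw [← hm]
        nlinarith
      by_cases hopt : opt (R ++ [r]) = 0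
      · have hr' := eq_zero_of_opt_eq_zero hR hopt (r := r) (by simp)
        have hρ0 : (run R).nextDist r ≤ 0 := by
          refine (baseDist_le_max _ _ _).trans ?_
          simp [hr']
        refine ⟨0, Finset.mem_union_left _ hhit.1, le_trans ?_ hrad⟩
        rw [hr'] at hm1
        rw [hr'] at hρ0
        simp only [sub_zero] at hm1
        rw [zero_sub, abs_neg]
        linarith
      · have hθ' := resolution_pos hopt
        -- The point of the widened request nearest to `x`; rounding it to the net costs at most
        -- another `m`, and `2 * m` is within the radius.
        have hu : ∃ u, 0 ≤ u ∧ r.1 - (run R).nextDist r ≤ u ∧ u ≤ r.1 + (run R).nextDist r ∧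
            |u - x| ≤ m := by
          have h3 := abs_le.1 (sub_le_iff_le_add.1 hm1)
          rcases le_total x (r.1 - (run R).nextDist r) with h4 | h4
          · exact ⟨_, hx.trans h4, le_rfl, by linarith, abs_le.2 ⟨by linarith, by linarith⟩⟩
          rcases le_total x (r.1 + (run R).nextDist r) with h5 | h5
          · exact ⟨x, hx, h4, h5, by simpa using hm0⟩
          · exact ⟨r.1 + (run R).nextDist r, by linarith, by linarith, le_rfl,
              abs_le.2 ⟨by linarith, by linarith⟩⟩
        obtain ⟨u, hu0, hu1, hu2, hux⟩ := hu
        obtain ⟨c, hc, hcu⟩ := exists_mem_net hθ' hu0 hu1 hu2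
        refine ⟨c, Finset.mem_union_right _ hc, le_trans ?_ hrad⟩
        have h6 := abs_sub_le c u x
        have h7 : resolution (scale (R ++ [r])) ≤ m := le_max_right _ _
        linarith
    · have hD : baseDist ((r, (run R).nextDist r) :: (run R).nextBase r) y x =
          baseDist ((run R).nextBase r) y x := h1
      obtain ⟨c, hc, hcx⟩ := hhit.2 x hx
      refine ⟨c, Finset.mem_union_left _ hc, hcx.trans ?_⟩
      unfold radius
      rw [hD]
      refine mul_le_mul_of_nonneg_left (max_le_max_right _ (baseDist_mono _ hy x)) ?_
      linarith
  · rw [hheight, hbase]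
    intro b hb
    rcases List.mem_cons.1 hb with rfl | hb
    · exact le_rfl
    · exact h.nextBase_le hr b hb

lemma IsInstance.invariant {R : List Point} (hR : IsInstance R) : Invariant R := by
  induction R using List.reverseRecOn with
  | nil => exact Invariant.nil
  | append_singleton R r ih => exact (ih hR.of_append).append hR

theorem isOnlineAlgorithm_algorithm : IsOnlineAlgorithm algorithm := by
  classical
  have hsegs : ∀ R r, IsInstance (R ++ [r]) → ∀ s ∈ algorithm (R ++ [r]),
      (∃ c ∈ (run R).nextCarried r, s.src = (c, (run R).height)) ∨
      (∃ c ∈ (run R).nextCarried r, s.src = (c, r.2)) ∨ s.src = r := by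
    intro R r hR s hs
    have h := hR.of_append.invariant
    have hr := h.height_le_next hR
    have hr0 := hR.nonneg r (by simp)
    have hρ := h.nextDist_nonneg hr
    simp only [algorithm, run_append, State.step, State.nextAdded, Finset.mem_union,
      Finset.mem_image, Finset.mem_insert, Finset.mem_singleton] at hs
    rcases hs with ⟨c, hc, rfl⟩ | rfl | rfl | rfl
    · exact Or.inl ⟨c, hc, (mkSeg_vertical (h.marks_nonneg c ((h.carried_spec hr).1 hc))
        h.height_nonneg hr).1⟩
    · have h1 := (h.server_spec hr hr0.1).1
      exact Or.inr (Or.inl ⟨_, h1, (mkSeg_horizontal hr0.2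
        (h.marks_nonneg _ ((h.carried_spec hr).1 h1)) hr0.1).1⟩)
    · exact Or.inr (Or.inr (mkSeg_horizontal hr0.2 hr0.1 (le_max_left _ _)).1)
    · exact Or.inr (Or.inr (mkSeg_horizontal hr0.2 hr0.1 (by linarith)).1)
  refine ⟨fun R r hR s hs q hq => ?_, fun R r hR s hs => ?_, fun R r hR => ?_⟩
  · have h := hR.of_append.invariant
    have h1 := h.le_height q hq
    have h2 := h.height_le_next hR
    rcases hsegs R r hR s hs with ⟨c, -, hc⟩ | ⟨c, -, hc⟩ | hc <;> rw [hc] <;>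
      first | exact h1 | exact h1.trans h2
  · have h := hR.of_append.invariant
    have hr := h.height_le_next hR
    obtain ⟨h1, h2, -⟩ := h.reachable_next hR
    rcases hsegs R r hR s hs with ⟨c, hc, hsc⟩ | ⟨c, hc, hsc⟩ | hsc
    · rw [hsc]
      exact (h.marks_reachable c ((h.carried_spec hr).1 hc)).mono
        (algorithm.solution_subset_append _ _)
    · rw [hsc]
      exact (h1 c hc).2
    · rwa [hsc]
  · generalize hT : R ++ [r] = T at hR
    clear hT
    induction T using List.reverseRecOn with
    | nil => simp [IsFeasible]
    | append_singleton T t ih =>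
      intro q hq
      rcases List.mem_append.1 hq with hq | hq
      · exact (ih hR.of_append q hq).mono (algorithm.solution_subset_append _ _)
      · rw [List.mem_singleton.1 hq]
        exact (hR.of_append.invariant.reachable_next hR).2.1

/-! ### Scales and their geometric sums. -/

lemma scale_fst_mono {R R' : List Point} (h : R.length ≤ R'.length) :
    (scale R).1 ≤ (scale R').1 :=
  Nat.clog_mono_right 2 (Nat.clog_mono_right 2 h)

lemma scale_snd_mono {R R' : List Point} (h : ∀ r ∈ R', 0 ≤ r.1 ∧ 0 ≤ r.2) (hs : R ⊆ R') :
    (scale R).2 ≤ (scale R').2 := by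
  have h1 := opt_mono h hs
  by_cases h0 : opt R = 0
  · refine le_trans (le_of_eq ?_) (scale_snd_nonneg R')
    simp [scale, h0]
  · have h2 : 0 < opt R := lt_of_le_of_ne (opt_nonneg R) (Ne.symm h0)
    have h3 : opt R' ≠ 0 := by linarith
    simp only [scale, if_neg h0, if_neg h3]
    exact zpow_le_zpow_right₀ one_le_two (Int.clog_mono_right h2 h1)

lemma opt_le_scale (R : List Point) : opt R ≤ (scale R).2 := by
  simp only [scale]
  split_ifs with h
  · exact h.le
  · exact_mod_cast Int.self_le_zpow_clog one_lt_two (opt R)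

lemma scale_le_opt (R : List Point) : (scale R).2 ≤ 2 * opt R := by
  simp only [scale]
  split_ifs with h
  · simp [h]
  · have h1 : 0 < opt R := lt_of_le_of_ne (opt_nonneg R) (Ne.symm h)
    have h2 := Int.zpow_pred_clog_lt_self (b := 2) one_lt_two h1
    rw [zpow_sub_one₀ (by norm_num)] at h2
    push_cast at h2
    linarith

lemma length_le_scale (R : List Point) : R.length ≤ 2 ^ 2 ^ (scale R).1 :=
  (Nat.le_pow_clog one_lt_two _).trans
    (Nat.pow_le_pow_right two_pos (Nat.le_pow_clog one_lt_two _))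

/-- Double rounding costs only a constant factor: rounding log log N up at most doubles the rounded
logarithm. So the square of the sparsity is O(log N). -/
lemma two_pow_scale_le {R : List Point} (h : 2 ≤ R.length) :
    (2 : ℝ) ^ (scale R).1 ≤ 6 * Real.log R.length := by
  set c := Nat.clog 2 R.length with hc
  have hc1 : 1 ≤ c := Nat.clog_pos one_lt_two h
  have h1 : 2 ^ (scale R).1 ≤ 2 * c := by
    change 2 ^ Nat.clog 2 c ≤ 2 * c
    rcases hc1.eq_or_lt with h2 | h2
    · simp [← h2]
    · have h3 := Nat.pow_pred_clog_lt_self one_lt_two h2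
      have h4 : 2 ^ Nat.clog 2 c = 2 * 2 ^ (Nat.clog 2 c).pred := by
        rw [← pow_succ']
        congr 1
        have := Nat.clog_pos one_lt_two h2
        simp only [Nat.pred_eq_sub_one]
        omega
      simp only [Nat.pred_eq_sub_one] at h3 h4
      omega
  have h2 : (2 : ℝ) ^ (scale R).1 ≤ 2 * c := by exact_mod_cast h1
  have h3 : 2 ^ (c - 1) < R.length := Nat.pow_pred_clog_lt_self one_lt_two h
  have h4 : (2 : ℝ) ^ (c - 1) ≤ R.length := by exact_mod_cast h3.le
  have h5 := Real.log_le_log (by positivity) h4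
  rw [Real.log_pow, Nat.cast_sub hc1, Nat.cast_one] at h5
  have h6 : Real.log 2 ≤ Real.log R.length :=
    Real.log_le_log two_pos (by exact_mod_cast h)
  have h7 := Real.log_two_gt_d9
  have h8 : (1 : ℝ) ≤ c := by exact_mod_cast hc1
  nlinarith

lemma sum_two_zpow_le (E : Finset ℤ) {k : ℤ} (h : ∀ l ∈ E, l ≤ k) :
    ∑ l ∈ E, (2 : ℝ) ^ l ≤ 2 * 2 ^ k := by
  have h1 : ∀ l ∈ E, (2 : ℝ) ^ l = 2 ^ k * (1 / 2) ^ (k - l).toNat := by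
    intro l hl
    have h2 : ((k - l).toNat : ℤ) = k - l := Int.toNat_of_nonneg (sub_nonneg.2 (h l hl))
    rw [one_div, inv_pow, ← zpow_natCast, h2, zpow_sub₀ two_ne_zero, inv_div,
      mul_div_cancel₀ _ (by positivity)]
  rw [Finset.sum_congr rfl h1, ← Finset.mul_sum, mul_comm 2]
  refine mul_le_mul_of_nonneg_left ?_ (by positivity)
  rw [← Finset.sum_image (f := fun i : ℕ => (1 / 2 : ℝ) ^ i) (g := fun l => (k - l).toNat)]
  · refine le_trans (Finset.sum_le_sum_of_subset_of_nonneg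
      (t := Finset.range ((E.image fun l => (k - l).toNat).sup id + 1)) ?_ ?_)
      (sum_geometric_two_le _)
    · intro i hi
      exact Finset.mem_range.2 (Nat.lt_succ_of_le (Finset.le_sup (f := id) hi))
    · intro i _ _
      positivity
  · intro a ha b hb hab
    have h3 := h a ha
    have h4 := h b hb
    simp only at hab
    omega

lemma sum_sqrt_two_pow_le (n : ℕ) :
    ∑ i ∈ Finset.range (n + 1), Real.sqrt (2 ^ i) ≤ 4 * Real.sqrt (2 ^ n) := by
  induction n with
  | zero => simp
  | succ n ih =>
    rw [Finset.sum_range_succ]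
    have h1 : Real.sqrt (2 ^ (n + 1)) = Real.sqrt (2 ^ n) * Real.sqrt 2 := by
      rw [pow_succ, Real.sqrt_mul (by positivity)]
    have h2 : (4 / 3 : ℝ) ≤ Real.sqrt 2 := Real.le_sqrt_of_sq_le (by norm_num)
    have h3 := Real.sqrt_nonneg ((2 : ℝ) ^ n)
    rw [h1]
    nlinarith

/-- The scales of the prefixes of a list of requests contribute geometric sums. -/
lemma sum_scales_le {R : List Point} (hR : IsInstance R) :
    ∑ κ ∈ (Finset.range R.length).image (fun i => scale (R.take (i + 1))), sparsity κ * κ.2 ≤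
      16 * sparsity (scale R) * opt R := by
  classical
  set K : Finset ℤ := ((Finset.range R.length).filter fun i => opt (R.take (i + 1)) ≠ 0).image
    fun i => Int.clog 2 (opt (R.take (i + 1))) with hK
  set O : Finset ℝ := insert 0 (K.image fun k => (2 : ℝ) ^ k) with hO
  -- Enlarging the set of scales to a product factors the sum into two geometric ones.
  have hsub : (Finset.range R.length).image (fun i => scale (R.take (i + 1))) ⊆
      Finset.range ((scale R).1 + 1) ×ˢ O := by
    intro κ hκ
    obtain ⟨i, hi, rfl⟩ := Finset.mem_image.1 hκ
    refine Finset.mem_product.2 ⟨Finset.mem_range.2 (Nat.lt_succ_of_le (scale_fst_mono (by simp))),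
      ?_⟩
    by_cases h : opt (R.take (i + 1)) = 0
    · exact Finset.mem_insert.2 (Or.inl (by simp [scale, h]))
    · refine Finset.mem_insert_of_mem (Finset.mem_image.2
        ⟨Int.clog 2 (opt (R.take (i + 1))), ?_, by simp [scale, h]⟩)
      exact Finset.mem_image.2 ⟨i, Finset.mem_filter.2 ⟨hi, h⟩, rfl⟩
  have hO0 : ∀ o ∈ O, 0 ≤ o := by
    intro o ho
    rcases Finset.mem_insert.1 ho with rfl | ho
    · exact le_rfl
    · obtain ⟨k, -, rfl⟩ := Finset.mem_image.1 ho
      positivity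
  have hOsum : ∑ o ∈ O, o ≤ 4 * opt R := by
    rw [hO, Finset.sum_insert_zero (f := fun o : ℝ => o) rfl, Finset.sum_image
      fun a _ b _ hab => zpow_right_injective₀ two_pos (by norm_num) hab]
    rcases K.eq_empty_or_nonempty with h | ⟨k, hk⟩
    · rw [h, Finset.sum_empty]
      have := opt_nonneg R
      linarith
    · have hpos : 0 < opt R := by
        obtain ⟨i, hi, -⟩ := Finset.mem_image.1 hk
        have h1 := (Finset.mem_filter.1 hi).2
        have h2 := opt_mono hR.nonneg (List.take_subset (i + 1) R)
        exact lt_of_lt_of_le (lt_of_le_of_ne (opt_nonneg _) (Ne.symm h1)) h2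
      have h3 := sum_two_zpow_le K (k := Int.clog 2 (opt R)) (by
        intro l hl
        obtain ⟨i, hi, rfl⟩ := Finset.mem_image.1 hl
        have h1 := (Finset.mem_filter.1 hi).2
        exact Int.clog_mono_right (lt_of_le_of_ne (opt_nonneg _) (Ne.symm h1))
          (opt_mono hR.nonneg (List.take_subset (i + 1) R)))
      have h4 := scale_le_opt R
      simp only [scale, if_neg hpos.ne'] at h4
      linarith
  have hopt := opt_nonneg R
  calc _ ≤ ∑ κ ∈ Finset.range ((scale R).1 + 1) ×ˢ O, sparsity κ * κ.2 := by
        refine Finset.sum_le_sum_of_subset_of_nonneg hsub fun κ hκ _ => ?_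
        exact mul_nonneg (Real.sqrt_nonneg _) (hO0 _ (Finset.mem_product.1 hκ).2)
    _ = (∑ m ∈ Finset.range ((scale R).1 + 1), Real.sqrt (2 ^ m)) * ∑ o ∈ O, o := by
        rw [Finset.sum_mul_sum, Finset.sum_product]
        rfl
    _ ≤ (4 * sparsity (scale R)) * (4 * opt R) :=
        mul_le_mul (sum_sqrt_two_pow_le _) hOsum (Finset.sum_nonneg hO0)
          (mul_nonneg (by norm_num) (Real.sqrt_nonneg _))
    _ = _ := by ring

/-! ### The competitive ratio: cost per step, per phase and in total. -/

section Analysis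

/-- The height of the `i`-th request (counted from one). -/
noncomputable def heightAt (R : List Point) (i : ℕ) : ℝ := (run (R.take i)).height

/-- The distance of the `i`-th request (counted from zero) from the base. -/
noncomputable def distAt (R : List Point) (i : ℕ) : ℝ := (run (R.take (i + 1))).dist

/-- The copies that are kept until the `i`-th request (counted from zero). -/
noncomputable def carriedAt (R : List Point) (i : ℕ) : Finset ℝ := (run (R.take (i + 1))).carried

/-- The position of the `i`-th request (counted from zero). -/
noncomputable def posAt (R : List Point) (i : ℕ) : ℝ := (R.getD i (0, 0)).1

/-- The scales after the `i`-th request (counted from zero). -/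
noncomputable def scaleAt (R : List Point) (i : ℕ) : ℕ × ℝ := scale (R.take (i + 1))

variable {R : List Point}

lemma take_succ_eq {i : ℕ} (hi : i < R.length) : R.take (i + 1) = R.take i ++ [R[i]] :=
  (List.take_append_getElem hi).symm

lemma IsInstance.take_append {i : ℕ} (hR : IsInstance R) (hi : i < R.length) :
    IsInstance (R.take i ++ [R[i]]) := take_succ_eq hi ▸ hR.take (i + 1)

lemma heightAt_succ {i : ℕ} (hi : i < R.length) : heightAt R (i + 1) = R[i].2 := by
  rw [heightAt, take_succ_eq hi, run_append]
  rfl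

lemma posAt_eq {i : ℕ} (hi : i < R.length) : posAt R i = R[i].1 := by
  rw [posAt, List.getD_eq_getElem _ _ hi]

lemma distAt_eq {i : ℕ} (hi : i < R.length) : distAt R i = (run (R.take i)).nextDist R[i] := by
  rw [distAt, take_succ_eq hi, run_append]
  rfl

lemma carriedAt_eq {i : ℕ} (hi : i < R.length) :
    carriedAt R i = (run (R.take i)).nextCarried R[i] := by
  rw [carriedAt, take_succ_eq hi, run_append]
  rfl

lemma scaleAt_eq {i : ℕ} (hi : i < R.length) : scaleAt R i = scale (R.take i ++ [R[i]]) := by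
  rw [scaleAt, take_succ_eq hi]

lemma heightAt_zero : heightAt R 0 = 0 := by simp [heightAt, run]

lemma heightAt_mono (hR : IsInstance R) : Monotone (heightAt R) := by
  refine monotone_nat_of_le_succ fun i => ?_
  rcases lt_or_ge i R.length with hi | hi
  · rw [heightAt_succ hi]
    exact (hR.take i).invariant.height_le_next (hR.take_append hi)
  · rw [heightAt, heightAt, List.take_of_length_le hi, List.take_of_length_le (by omega)]

/-- Both scales are monotone along the sequence, so equal scales occur consecutively. Hence the base
consists of exactly the earlier requests with the same scales. -/
lemma scaleAt_eq_of_between (hR : IsInstance R) {i j l : ℕ} (hjl : j ≤ l) (hli : l ≤ i)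
    (h : scaleAt R j = scaleAt R i) : scaleAt R l = scaleAt R i := by
  have h1 : ∀ {i j : ℕ}, i ≤ j → (scaleAt R i).1 ≤ (scaleAt R j).1 ∧
      (scaleAt R i).2 ≤ (scaleAt R j).2 := by
    intro i j hij
    refine ⟨scale_fst_mono (by simp; omega), scale_snd_mono (hR.take _).nonneg ?_⟩
    exact ((List.take_prefix_take_left (Nat.succ_le_succ hij))).subset
  have h2 := h1 hjl
  have h3 := h1 hli
  rw [h] at h2
  exact Prod.ext (le_antisymm h3.1 h2.1) (le_antisymm h3.2 h2.2)

lemma nextBase_eq {i : ℕ} (hi : i < R.length) : (run (R.take i)).nextBase R[i] =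
    if scaleAt R i = (run (R.take i)).key then (run (R.take i)).base else [] := by
  rw [State.nextBase, run_hist, scaleAt_eq hi]

lemma key_succ {i : ℕ} (hi : i < R.length) : (run (R.take (i + 1))).key = scaleAt R i := by
  rw [scaleAt_eq hi, take_succ_eq hi, run_append]
  simp only [State.step, run_hist]

lemma base_succ {i : ℕ} (hi : i < R.length) : (run (R.take (i + 1))).base =
    (R[i], distAt R i) :: (run (R.take i)).nextBase R[i] := by
  rw [distAt_eq hi, take_succ_eq hi, run_append]
  rfl

lemma mem_nextBase_of_base (hR : IsInstance R) {i : ℕ} (hi : i < R.length)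
    (h : ∀ b, b ∈ (run (R.take i)).base ↔ ∃ j, ∃ hj : j < R.length, j < i ∧
      scaleAt R j = (run (R.take i)).key ∧ b = (R[j], distAt R j)) (b : Point × ℝ) :
    b ∈ (run (R.take i)).nextBase R[i] ↔ ∃ j, ∃ hj : j < R.length, j < i ∧
      scaleAt R j = scaleAt R i ∧ b = (R[j], distAt R j) := by
  rw [nextBase_eq hi]
  split_ifs with hk
  · rw [h b, hk]
  · refine iff_of_false (by simp) ?_
    rintro ⟨j, hj, hji, hs, -⟩
    obtain ⟨l, rfl⟩ : ∃ l, i = l + 1 := ⟨i - 1, by omega⟩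
    refine hk ?_
    rw [key_succ (by omega)]
    exact (scaleAt_eq_of_between hR (by omega) (by omega) hs).symm

lemma mem_base_iff (hR : IsInstance R) {i : ℕ} (hi : i ≤ R.length) (b : Point × ℝ) :
    b ∈ (run (R.take i)).base ↔ ∃ j, ∃ hj : j < R.length, j < i ∧
      scaleAt R j = (run (R.take i)).key ∧ b = (R[j], distAt R j) := by
  induction i generalizing b with
  | zero => simp [run]
  | succ i ih =>
    have hi' : i < R.length := hi
    rw [base_succ hi', key_succ hi', List.mem_cons,
      mem_nextBase_of_base hR hi' fun b => ih hi'.le b]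
    constructor
    · rintro (rfl | ⟨j, hj, hji, hs, rfl⟩)
      · exact ⟨i, hi', by omega, rfl, rfl⟩
      · exact ⟨j, hj, by omega, hs, rfl⟩
    · rintro ⟨j, hj, hji, hs, rfl⟩
      rcases Nat.lt_succ_iff_lt_or_eq.1 hji with h | rfl
      · exact Or.inr ⟨j, hj, h, hs, rfl⟩
      · exact Or.inl rfl

lemma mem_nextBase_iff (hR : IsInstance R) {i : ℕ} (hi : i < R.length) (b : Point × ℝ) :
    b ∈ (run (R.take i)).nextBase R[i] ↔ ∃ j, ∃ hj : j < R.length, j < i ∧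
      scaleAt R j = scaleAt R i ∧ b = (R[j], distAt R j) :=
  mem_nextBase_of_base hR hi (fun b => mem_base_iff hR hi.le b) b

lemma distAt_nonneg (hR : IsInstance R) {i : ℕ} (hi : i < R.length) : 0 ≤ distAt R i := by
  rw [distAt_eq hi]
  exact (hR.take i).invariant.nextDist_nonneg
    ((hR.take i).invariant.height_le_next (hR.take_append hi))

lemma distAt_le_max (hR : IsInstance R) {i : ℕ} (hi : i < R.length) :
    distAt R i ≤ max (posAt R i) (heightAt R (i + 1)) := by
  rw [distAt_eq hi, posAt_eq hi, heightAt_succ hi]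
  have h := baseDist_le_max ((run (R.take i)).nextBase R[i]) R[i].2 R[i].1
  rwa [abs_of_nonneg (hR.nonneg _ (List.getElem_mem hi)).1] at h

lemma distAt_le_of_lt (hR : IsInstance R) {i j : ℕ} (hi : i < R.length) (hji : j < i)
    (hs : scaleAt R j = scaleAt R i) :
    distAt R i ≤ max (|posAt R i - posAt R j| - distAt R j)
      (heightAt R (i + 1) - heightAt R (j + 1)) := by
  have hj : j < R.length := hji.trans hi
  have h := baseDist_le_of_mem ((mem_nextBase_iff hR hi (R[j], distAt R j)).2
    ⟨j, hj, hji, hs, rfl⟩) R[i].2 R[i].1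
  rw [posAt_eq hi, posAt_eq hj, heightAt_succ hi, heightAt_succ hj, distAt_eq hi]
  exact h

/-- Every copy, except the one at the origin, is kept for the sake of some position `z`. -/
lemma exists_witness (hR : IsInstance R) {i : ℕ} (hi : i < R.length) {c : ℝ}
    (hc : c ∈ carriedAt R i) (hc0 : c ≠ 0) :
    ∃ (z a : ℝ) (j : ℕ), j < i ∧ scaleAt R j = scaleAt R i ∧ resolution (scaleAt R i) ≤ a ∧
      heightAt R (i + 1) - a ≤ heightAt R (j + 1) ∧ |z - posAt R j| ≤ distAt R j + a ∧
      4 * sparsity (scaleAt R i) * a < z ∧ |c - z| ≤ 4 * sparsity (scaleAt R i) * a ∧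
      ∀ c' ∈ carriedAt R i, |c' - z| ≤ 4 * sparsity (scaleAt R i) * a → c' = c := by
  have hinv := (hR.take i).invariant
  obtain ⟨-, hhit, hirr⟩ := hinv.carried_spec (hinv.height_le_next (hR.take_append hi))
  have h1 := hirr c (by rwa [← carriedAt_eq hi]) hc0
  rw [← carriedAt_eq hi, ← scaleAt_eq hi] at hhit h1
  -- Irredundancy: without `c` some position `z` is not hit. Since the copy at 0 misses it too, `z`
  -- is far from column 0.
  have h2 : ∃ z, 0 ≤ z ∧ ∀ c' ∈ (carriedAt R i).erase c,
      radius (scaleAt R i) ((run (R.take i)).nextBase R[i]) R[i].2 z < |c' - z| := by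
    by_contra! hcon
    exact h1 ⟨Finset.mem_erase.2 ⟨hc0.symm, hhit.1⟩, hcon⟩
  obtain ⟨z, hz0, hz⟩ := h2
  set D := baseDist ((run (R.take i)).nextBase R[i]) R[i].2 z with hD
  set a := max D (resolution (scaleAt R i)) with ha
  have hrad : radius (scaleAt R i) ((run (R.take i)).nextBase R[i]) R[i].2 z =
      4 * sparsity (scaleAt R i) * a := rfl
  rw [hrad] at hz
  have huniq : ∀ c' ∈ carriedAt R i, |c' - z| ≤ 4 * sparsity (scaleAt R i) * a → c' = c := by
    intro c' hc' hle
    by_contra hne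
    exact absurd (hz c' (Finset.mem_erase.2 ⟨hne, hc'⟩)) (not_lt.2 hle)
  have hza : 4 * sparsity (scaleAt R i) * a < z := by
    have := hz 0 (Finset.mem_erase.2 ⟨hc0.symm, hhit.1⟩)
    rwa [zero_sub, abs_neg, abs_of_nonneg hz0] at this
  obtain ⟨c', hc', hcz⟩ := hhit.2 z hz0
  rw [hrad] at hcz
  rw [huniq c' hc' hcz] at hcz
  rcases baseDist_eq ((run (R.take i)).nextBase R[i]) R[i].2 z with h3 | ⟨b, hb, h3⟩
  -- The distance cannot come from the origin: that would give `z ≤ a`, contrary to `hza`.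
  · exfalso
    have h4 : z ≤ a := (le_abs_self z).trans ((le_max_left _ R[i].2).trans
      (h3.symm.le.trans (le_max_left _ _)))
    have h5 := one_le_sparsity (scaleAt R i)
    nlinarith
  · obtain ⟨j, hj, hji, hs, rfl⟩ := (mem_nextBase_iff hR hi b).1 hb
    have h4 : max (|z - R[j].1| - distAt R j) (R[i].2 - R[j].2) ≤ a :=
      h3.symm.le.trans (le_max_left _ _)
    have h5 := (le_max_left _ _).trans h4
    have h6 := (le_max_right _ _).trans h4
    refine ⟨z, a, j, hji, hs, le_max_right _ _, ?_, ?_, hza, hcz, huniq⟩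
    · rw [heightAt_succ hi, heightAt_succ hj]
      linarith
    · rw [posAt_eq hj]
      linarith

/-- The cost of a single step. -/
lemma cost_step_le (hR : IsInstance R) {i : ℕ} (hi : i < R.length) :
    cost (algorithm (R.take (i + 1))) ≤ (heightAt R (i + 1) - heightAt R i) +
      ((heightAt R (i + 1) - heightAt R i) * ((carriedAt R i).erase 0).card +
      4 * sparsity (scaleAt R i) * max (distAt R i) (resolution (scaleAt R i)) +
      2 * distAt R i) := by
  classical
  have hinv := (hR.take i).invariant
  have hr := hinv.height_le_next (hR.take_append hi)
  have hr0 := hR.nonneg _ (List.getElem_mem hi)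
  have hρ := distAt_nonneg hR hi
  obtain ⟨hsub, hhit, -⟩ := hinv.carried_spec hr
  obtain ⟨hserve, hserve'⟩ := hinv.server_spec hr hr0.1
  have hs0 := hinv.marks_nonneg _ (hsub hserve)
  have hadd : algorithm (R.take (i + 1)) = (run (R.take i)).nextAdded R[i] := by
    rw [take_succ_eq hi]
    simp only [algorithm, run_append]
    rfl
  rw [hadd, State.nextAdded]
  refine (cost_union_le _ _).trans ?_
  have h1 : cost (((run (R.take i)).nextCarried R[i]).image
      fun c => mkSeg (c, (run (R.take i)).height) (c, R[i].2)) ≤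
      (heightAt R (i + 1) - heightAt R i) * (((carriedAt R i).erase 0).card + 1) := by
    have h2 : ∀ s ∈ ((run (R.take i)).nextCarried R[i]).image
        fun c => mkSeg (c, (run (R.take i)).height) (c, R[i].2),
        s.length ≤ heightAt R (i + 1) - heightAt R i := by
      intro s hs
      obtain ⟨c, hc, rfl⟩ := Finset.mem_image.1 hs
      rw [(mkSeg_vertical (hinv.marks_nonneg c (hsub hc)) hinv.height_nonneg hr).2.2,
        heightAt_succ hi]
      rfl
    refine (Finset.sum_le_card_nsmul _ _ _ h2).trans ?_
    rw [nsmul_eq_mul, mul_comm]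
    refine mul_le_mul_of_nonneg_left ?_ (sub_nonneg.2 (heightAt_mono hR i.le_succ))
    have h3 : (0 : ℝ) ∈ carriedAt R i := by
      rw [carriedAt_eq hi]
      exact hhit.1
    rw [← Nat.cast_add_one, Finset.card_erase_add_one h3, carriedAt_eq hi]
    exact_mod_cast Finset.card_image_le
  have h2 : ∀ s₁ s₂ s₃ : Seg, cost {s₁, s₂, s₃} ≤ s₁.length + (s₂.length + s₃.length) := by
    intro s₁ s₂ s₃
    rw [Finset.insert_eq, Finset.insert_eq]
    refine (cost_union_le _ _).trans (add_le_add (by simp [cost]) ?_)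
    refine (cost_union_le _ _).trans (by simp [cost])
  refine (add_le_add h1 (h2 _ _ _)).trans ?_
  rw [(mkSeg_horizontal hr0.2 hs0 hr0.1).2.2,
    (mkSeg_horizontal hr0.2 hr0.1 (le_max_left _ _)).2.2, ← distAt_eq hi,
    (mkSeg_horizontal hr0.2 hr0.1 (by linarith)).2.2, add_sub_cancel_left, abs_of_nonneg hρ,
    abs_sub_comm]
  have h3 : |max 0 (R[i].1 - distAt R i) - R[i].1| ≤ distAt R i := by
    have h4 := le_max_right 0 (R[i].1 - distAt R i)
    have h5 : max 0 (R[i].1 - distAt R i) ≤ R[i].1 := max_le hr0.1 (by linarith)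
    exact abs_le.2 ⟨by linarith, by linarith⟩
  have h4 : |(run (R.take i)).server R[i] - R[i].1| ≤
      4 * sparsity (scaleAt R i) * max (distAt R i) (resolution (scaleAt R i)) := by
    rw [scaleAt_eq hi, distAt_eq hi]
    exact hserve'
  linarith

/-- The cost of the step for the `i`-th request, apart from the copy at the origin. -/
noncomputable def stepCost (R : List Point) (i : ℕ) : ℝ :=
  (heightAt R (i + 1) - heightAt R i) * ((carriedAt R i).erase 0).card +
    4 * sparsity (scaleAt R i) * max (distAt R i) (resolution (scaleAt R i)) + 2 * distAt R i

/-- With u = 2^(2^κ.1) ≥ 2 the quotient is at most 1 + 2u ≤ u³, and log₂ u is the square of the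
sparsity. -/
lemma log_resolution_le {κ : ℕ × ℝ} (hκ : 0 < κ.2) {y : ℝ} (hy0 : 0 ≤ y) (hy : y ≤ 2 * κ.2) :
    Real.log ((resolution κ + y) / resolution κ) ≤ 3 * sparsity κ ^ 2 := by
  have hu : (2 : ℝ) ≤ 2 ^ 2 ^ κ.1 := by
    calc (2 : ℝ) = 2 ^ 1 := (pow_one _).symm
      _ ≤ _ := pow_le_pow_right₀ one_le_two Nat.one_le_two_pow
  have hθ : 0 < resolution κ := div_pos hκ (by positivity)
  have h1 : (resolution κ + y) / resolution κ ≤ ((2 : ℝ) ^ 2 ^ κ.1) ^ 3 := by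
    rw [div_le_iff₀ hθ]
    have h2 : κ.2 = 2 ^ 2 ^ κ.1 * resolution κ := by
      rw [resolution]
      field_simp
    set u : ℝ := 2 ^ 2 ^ κ.1
    have h3 : 1 + 2 * u ≤ u ^ 3 := by nlinarith [mul_self_nonneg (u - 2)]
    nlinarith
  refine (Real.log_le_log (by positivity) h1).trans ?_
  rw [Real.log_pow, Real.log_pow, sparsity, Real.sq_sqrt (by positivity)]
  push_cast
  have h4 : Real.log 2 ≤ 1 := by linarith [Real.log_two_lt_d9]
  have h5 : (0 : ℝ) < 2 ^ κ.1 := by positivity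
  nlinarith

/-- The cost of the steps with given scales. -/
lemma sum_stepCost_le (hR : IsInstance R) {κ : ℕ × ℝ} (hκ : 0 < κ.2) :
    ∑ i ∈ (Finset.range R.length).filter (fun i => scaleAt R i = κ), stepCost R i ≤
      1000 * (sparsity κ * κ.2) := by
  classical
  set E := (Finset.range R.length).filter (fun i => scaleAt R i = κ) with hE
  have hδ := one_le_sparsity κ
  rcases E.eq_empty_or_nonempty with h0 | hne
  · rw [h0, Finset.sum_empty]
    positivity
  obtain ⟨q, hq, hmax⟩ := Finset.exists_max_image E id hne
  have hmem : ∀ i ∈ E, ∃ _ : i < R.length, scaleAt R i = κ := fun i hi => by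
    have := Finset.mem_filter.1 hi
    exact ⟨Finset.mem_range.1 this.1, this.2⟩
  obtain ⟨hqn, hqκ⟩ := hmem q hq
  have hEq : E ⊆ Finset.range (q + 1) := fun i hi =>
    Finset.mem_range.2 (Nat.lt_succ_of_le (hmax i hi))
  -- The infimum need not be attained; the slack provides an actual solution `F` for all requests up
  -- to the end of the phase.
  have hopt : opt (R.take (q + 1)) < 2 * κ.2 := by
    have := opt_le_scale (R.take (q + 1))
    rw [← hqκ] at hκ ⊢
    have h2 : (scaleAt R q).2 = (scale (R.take (q + 1))).2 := rfl
    linarith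
  obtain ⟨F, hF, hFκ⟩ := exists_feasible_cost_lt (hR.take (q + 1)).nonneg hopt
  have hreach : ∀ i ∈ E, Reachable F (posAt R i, heightAt R (i + 1)) := by
    intro i hi
    obtain ⟨hin, -⟩ := hmem i hi
    rw [posAt_eq hin, heightAt_succ hin]
    refine hF R[i] ?_
    have := Finset.mem_range.1 (hEq hi)
    exact List.mem_take_iff_getElem.2 ⟨i, by omega, rfl⟩
  have hρ : ∀ i ∈ E, 0 ≤ distAt R i := fun i hi => distAt_nonneg hR (hmem i hi).1
  have hsum := sum_dist_le_cost hρ hreach (fun i hi => distAt_le_max hR (hmem i hi).1)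
    (fun i hi j hj hji => distAt_le_of_lt hR (hmem i hi).1 hji
      ((hmem j hj).2.trans (hmem i hi).2.symm))
  have hheight0 : ∀ i, 0 ≤ heightAt R i := fun i =>
    heightAt_zero.symm.le.trans (heightAt_mono hR (Nat.zero_le i))
  have hheight : heightAt R (q + 1) ≤ 2 * κ.2 := by
    refine le_trans ?_ hopt.le
    rw [heightAt_succ hqn]
    exact snd_le_opt (hR.take (q + 1)).nonneg (List.mem_take_iff_getElem.2 ⟨q, by omega, rfl⟩)
  have hθ : 0 < resolution κ := div_pos hκ (by positivity)
  have hwit : ∀ i c, ∃ (z a : ℝ) (j : ℕ), i ∈ E → c ∈ (carriedAt R i).erase 0 →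
      j < i ∧ scaleAt R j = scaleAt R i ∧ resolution (scaleAt R i) ≤ a ∧
      heightAt R (i + 1) - a ≤ heightAt R (j + 1) ∧ |z - posAt R j| ≤ distAt R j + a ∧
      4 * sparsity (scaleAt R i) * a < z ∧ |c - z| ≤ 4 * sparsity (scaleAt R i) * a ∧
      ∀ c' ∈ carriedAt R i, |c' - z| ≤ 4 * sparsity (scaleAt R i) * a → c' = c := by
    intro i c
    by_cases h : i ∈ E ∧ c ∈ (carriedAt R i).erase 0
    · obtain ⟨z, a, j, hw⟩ := exists_witness hR (hmem i h.1).1 (Finset.mem_of_mem_erase h.2)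
        (Finset.ne_of_mem_erase h.2)
      exact ⟨z, a, j, fun _ _ => hw⟩
    · exact ⟨0, 0, 0, fun h1 h2 => absurd ⟨h1, h2⟩ h⟩
  choose z a j hw using hwit
  -- `M` is ten times the scale: at most 2 for `F`, and 8 for the widened requests by `hsum`.
  have hcopies := sum_copies_le (F := F) (E := E) (n := q + 1) (Y := heightAt R) (x := posAt R)
    (ρ := distAt R) (S := fun i => (carriedAt R i).erase 0) (z := z) (a := a) (j := j)
    (θ := resolution κ) (δ := sparsity κ) (M := 10 * κ.2) (heightAt_mono hR)
    heightAt_zero.symm.le hEq hδ hθ hρ hreach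
    (fun i hi c hc => by
      obtain ⟨hin, hiκ⟩ := hmem i hi
      obtain ⟨w1, w2, w3, w4, w5, w6, -⟩ := hw i c hi hc
      rw [hiκ] at w2 w3 w6
      exact ⟨Finset.mem_filter.2 ⟨Finset.mem_range.2 (w1.trans hin), w2⟩, w1, w3, w4, w5, w6⟩)
    (fun i hi c hc => by
      have := (hw i c hi hc).2.2.2.2.2.2.1
      rwa [(hmem i hi).2] at this)
    (fun i hi c hc c' hc' hle => by
      refine (hw i c hi hc).2.2.2.2.2.2.2 c' (Finset.mem_of_mem_erase hc') ?_
      rwa [(hmem i hi).2])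
    (by linarith)
  have hlog := log_resolution_le hκ (hheight0 (q + 1)) hheight
  -- The logarithm is at most three times the square of the sparsity, so dividing by the sparsity
  -- leaves one power of it: this is the balance behind its choice.
  have hfactor : 18 + 2 * (1 / sparsity κ *
      (1 + 10 * Real.log ((resolution κ + heightAt R (q + 1)) / resolution κ))) ≤
      80 * sparsity κ := by
    have h1 : 1 / sparsity κ *
        (1 + 10 * Real.log ((resolution κ + heightAt R (q + 1)) / resolution κ)) ≤
        31 * sparsity κ := by
      rw [one_div_mul_eq_div, div_le_iff₀ (by linarith)]
      nlinarith
    linarith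
  -- The resolution is small enough that paying it once per request of the phase costs at most the
  -- scale.
  have hcard : (E.card : ℝ) * resolution κ ≤ κ.2 := by
    have h1 : E.card ≤ 2 ^ 2 ^ κ.1 := by
      refine (Finset.card_le_card hEq).trans ?_
      rw [Finset.card_range, ← hqκ]
      have := length_le_scale (R.take (q + 1))
      rwa [List.length_take, min_eq_left (by omega)] at this
    have h2 : (E.card : ℝ) ≤ 2 ^ 2 ^ κ.1 := by exact_mod_cast h1
    refine (mul_le_mul_of_nonneg_right h2 hθ.le).trans (le_of_eq ?_)
    rw [resolution]
    field_simp
  have hserve : ∑ i ∈ E, max (distAt R i) (resolution κ) ≤ 5 * κ.2 := by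
    have : ∑ i ∈ E, max (distAt R i) (resolution κ) ≤
        ∑ i ∈ E, (distAt R i + resolution κ) := Finset.sum_le_sum fun i hi =>
      max_le_add_of_nonneg (hρ i hi) hθ.le
    rw [Finset.sum_add_distrib, Finset.sum_const, nsmul_eq_mul] at this
    linarith
  have htotal : ∑ i ∈ E, stepCost R i =
      ∑ i ∈ E, (heightAt R (i + 1) - heightAt R i) * ((carriedAt R i).erase 0).card +
      4 * sparsity κ * ∑ i ∈ E, max (distAt R i) (resolution κ) + 2 * ∑ i ∈ E, distAt R i := by
    rw [Finset.mul_sum, Finset.mul_sum, ← Finset.sum_add_distrib, ← Finset.sum_add_distrib]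
    refine Finset.sum_congr rfl fun i hi => ?_
    rw [stepCost, (hmem i hi).2]
  rw [htotal]
  have h1 := mul_le_mul_of_nonneg_right hfactor (by linarith : 0 ≤ 10 * κ.2)
  have h2 := mul_le_mul_of_nonneg_left hserve (by linarith : 0 ≤ 4 * sparsity κ)
  have h3 := mul_le_mul_of_nonneg_right hδ hκ.le
  nlinarith

/-- Covers the phase of scale 0, which `sum_stepCost_le` excludes. -/
lemma stepCost_nonpos (hR : IsInstance R) {i : ℕ} (hi : i < R.length)
    (h : (scaleAt R i).2 = 0) : stepCost R i ≤ 0 := by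
  have hopt := opt_eq_zero_of_scale h
  have h1 := eq_zero_of_opt_eq_zero (hR.take (i + 1)) hopt
    (List.mem_take_iff_getElem.2 ⟨i, by omega, rfl⟩ : R[i] ∈ R.take (i + 1))
  have h2 : heightAt R (i + 1) = 0 := by rw [heightAt_succ hi, h1]
  have h3 : heightAt R i = 0 := le_antisymm (h2 ▸ heightAt_mono hR i.le_succ)
    (heightAt_zero.symm.le.trans (heightAt_mono hR (Nat.zero_le i)))
  have h4 : distAt R i = 0 := le_antisymm
    ((distAt_le_max hR hi).trans (by rw [posAt_eq hi, h1, h2, max_self])) (distAt_nonneg hR hi)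
  have h5 : resolution (scaleAt R i) = 0 := by rw [resolution, h, zero_div]
  rw [stepCost, h2, h3, h4, h5]
  simp

lemma cost_solution_le (A : Strategy) (R : List Point) :
    cost (A.solution R) ≤ ∑ i ∈ Finset.range R.length, cost (A (R.take (i + 1))) := by
  classical
  unfold Strategy.solution
  generalize R.length = n
  induction n with
  | zero => simp [cost]
  | succ n ih =>
    rw [Finset.sum_range_succ, Finset.range_add_one, Finset.biUnion_insert]
    refine (cost_union_le _ _).trans ?_
    linarith

/-- The algorithm is competitive. -/
theorem isCompetitive_algorithm :
    IsCompetitive algorithm (fun N => 60000 * Real.sqrt (Real.log (N : ℝ))) := by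
  classical
  intro R hR hN
  have hopt := opt_nonneg R
  have h1 : cost (algorithm.solution R) ≤
      heightAt R R.length + ∑ i ∈ Finset.range R.length, stepCost R i := by
    refine (cost_solution_le algorithm R).trans ((Finset.sum_le_sum fun i hi =>
      cost_step_le hR (Finset.mem_range.1 hi)).trans (le_of_eq ?_))
    rw [Finset.sum_add_distrib, Finset.sum_range_sub, heightAt_zero, sub_zero]
    rfl
  have h2 : heightAt R R.length ≤ opt R := by
    obtain ⟨n, hn⟩ : ∃ n, R.length = n + 1 := ⟨R.length - 1, by omega⟩
    rw [hn, heightAt_succ (by omega)]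
    exact snd_le_opt hR.nonneg (List.getElem_mem _)
  have h3 : ∑ i ∈ Finset.range R.length, stepCost R i ≤
      1000 * (16 * sparsity (scale R) * opt R) := by
    -- Grouping the steps by scale turns the sum into one over phases.
    rw [← Finset.sum_fiberwise_of_maps_to (fun i hi => Finset.mem_image_of_mem
      (fun i => scaleAt R i) hi)]
    refine le_trans ?_ (mul_le_mul_of_nonneg_left (sum_scales_le hR) (by norm_num))
    rw [Finset.mul_sum]
    refine Finset.sum_le_sum fun κ hκ => ?_
    have h4 : 0 ≤ κ.2 := by
      obtain ⟨i, -, rfl⟩ := Finset.mem_image.1 hκ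
      exact scale_snd_nonneg _
    rcases h4.eq_or_lt with h5 | h5
    · rw [← h5, mul_zero, mul_zero]
      refine Finset.sum_nonpos fun i hi => ?_
      obtain ⟨hi1, rfl⟩ := Finset.mem_filter.1 hi
      exact stepCost_nonpos hR (Finset.mem_range.1 hi1) h5.symm
    · exact sum_stepCost_le hR h5
  have h4 : sparsity (scale R) ≤ 3 * Real.sqrt (Real.log R.length) := by
    refine Real.sqrt_le_iff.2 ⟨by positivity, ?_⟩
    have h5 : 0 ≤ Real.log R.length := Real.log_natCast_nonneg _
    rw [mul_pow, Real.sq_sqrt h5]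
    linarith [two_pow_scale_le hN]
  have h5 := mul_le_mul_of_nonneg_right h4 hopt
  have h6 := mul_le_mul_of_nonneg_right (one_le_sparsity (scale R)) hopt
  have h7 : 0 ≤ Real.sqrt (Real.log R.length) * opt R := by positivity
  calc cost (algorithm.solution R) ≤ opt R + 1000 * (16 * sparsity (scale R) * opt R) :=
        h1.trans (add_le_add h2 h3)
    _ ≤ 60000 * (Real.sqrt (Real.log R.length) * opt R) := by linarith
    _ = _ := by ring

end Analysis

end SRSA

theorem mainTheorem2 :
    (∃ (A : SRSA.Strategy) (C : ℝ), SRSA.IsOnlineAlgorithm A ∧ 0 < C ∧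
      SRSA.IsCompetitive A (fun N => C * Real.sqrt (Real.log (N : ℝ)))) ∧
    (∃ c : ℝ, 0 < c ∧ ∀ B : SRSA.Strategy, SRSA.IsOnlineAlgorithm B → ∀ N : ℕ, 2 ≤ N →
      ∃ R : List SRSA.Point, SRSA.IsInstance R ∧ R.length = N ∧ 0 < SRSA.opt R ∧
        c * Real.sqrt (Real.log (N : ℝ)) * SRSA.opt R ≤ SRSA.cost (B.solution R)) := by
  exact ⟨⟨SRSA.algorithm, 60000, SRSA.isOnlineAlgorithm_algorithm, by norm_num,
    SRSA.isCompetitive_algorithm⟩, SRSA.exists_lower_bound⟩
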